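/- **The model.** Let $p\in(\tfrac12,1]$ and toss independent identical coins, numbered $1,2,3,\dots$, each of which comes up heads with probability $p$ and tails with probability $1-p$. Let $\Delta_i$ be the number of heads minus the number of tails among the first $i$ tosses. When $N$ tosses are made, each head is colored red or blue: if the $i$-th toss ($1\le i\le N$) is a head, it is red if and only if 1. $\Delta_j\ge\Delta_i$ for all $j=i+1,\dots,N$, and 2. whenever $1\le k<i$ and $\Delta_k\ge\Delta_i$, there is $l$ with $k<l<i$ and $\Delta_l<\Delta_i$; otherwise it is blue. A run of $k$ red heads is a set of $k$ heads that are consecutive in the sequence of all heads and that are all red. Let $\mathcal E_{k,N}$ be the expected number of runs of $k$ red heads (counted by starting point, so that runs may overlap) among $N$ tosses. Let $L_N$ be the length of the longest run of red heads among $N$ tosses ($L_N=0$ if there is no red head), and let $L'_N$ be the same length when the coin is tossed until a total of $N$ heads has come up, the coloring being done with respect to the tosses made. **Proposition 2.3.** (a) For $\tfrac12<p\le 1$ and every fixed integer $k\ge1$, $$\frac{\mathcal E_{k,N}}{N}\le p^{k-1}\quad\text{for all } N\ge1,$$ and for every real $c<\frac{(2p-1)^2}{p}\,p^{k-1}$ one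 has $\frac{\mathcal E_{k,N}}{N}>c$ for all sufficiently large $N$; that is, $\frac{(2p-1)^2}{p}\,p^{k-1}\le\liminf_{N\to\infty}\frac{\mathcal E_{k,N}}{N}$. (b) For $\tfrac12<p<1$, the expected length of the longest run of consecutive red heads is approximately $\frac{\log N}{\log(1/p)}$, both among $N$ tosses and among a total of $N$ heads: as $N\to\infty$, $$\mathbb E[L_N]\sim\frac{\log N}{\log(1/p)},\qquad \mathbb E[L'_N]\sim\frac{\log N}{\log(1/p)}.$$ (c) For $\tfrac12<p<1$, one needs on the order of $(1/p)^k$ tosses to see a run of $k$ red heads with reasonable probability: for every $\varepsilon>0$ there are constants $c,C>0$, depending only on $p$ and $\varepsilon$, such that for all integers $k\ge1$ and $N\ge0$, the probability that $N$ tosses contain a run of $k$ red heads is at most $\varepsilon$ if $N\le c\,(1/p)^k$, and at least $1-\varepsilon$ if $N\ge C\,(1/p)^k$. (d) In particular, for $p=\tfrac23$ one has $\mathbb E[L_N]\sim\frac{\log N}{\log(3/2)}$ and $\mathbb E[L'_N]\sim\frac{\log N}{\log(3/2)}$, and (c) holds with $(3/2)^k$ in place of $(1/p)^k$. -/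

import Mathlib

open Filter MeasureTheory

namespace RedHeads

/-- The law of an infinite sequence `ω : ℕ → Bool` of independent tosses of identical coins that
come up heads with probability `p`. The tosses are numbered `1, 2, 3, …`, and `ω i = true` means
that the `i`-th toss is a head. The entry `ω 0` is never used. -/
noncomputable def tossMeasure (p : unitInterval) : Measure (ℕ → Bool) :=
  Measure.infinitePi fun _ : ℕ => ProbabilityTheory.bernoulliMeasure true false p

/-- The number of heads among the first `i` tosses. -/
def heads (ω : ℕ → Bool) (i : ℕ) : ℕ := ((Finset.Icc 1 i).filter fun j => ω j = true).card

/-- The number of tails among the first `i` tosses. -/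
def tails (ω : ℕ → Bool) (i : ℕ) : ℕ := ((Finset.Icc 1 i).filter fun j => ω j = false).card

/-- The difference `Δ_i` of the numbers of heads and tails among the first `i` tosses. -/
def Delta (ω : ℕ → Bool) (i : ℕ) : ℤ := (heads ω i : ℤ) - (tails ω i : ℤ)

/-- When the first `N` tosses are made, the `i`-th toss is a head that is colored red. -/
def IsRed (ω : ℕ → Bool) (N i : ℕ) : Prop :=
  (1 ≤ i ∧ i ≤ N ∧ ω i = true) ∧
  (∀ j ∈ Finset.Icc (i + 1) N, Delta ω i ≤ Delta ω j) ∧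
  (∀ k ∈ Finset.Ico 1 i, Delta ω i ≤ Delta ω k → ∃ l ∈ Finset.Ioo k i, Delta ω l < Delta ω i)

/-- When the first `N` tosses are made, a run of `k` consecutive red heads starts at the `a`-th
toss: the tosses `a` and `b` are heads, exactly `k` of the tosses `a, …, b` are heads, and all of
these `k` heads are red. "Consecutive" refers to the sequence of heads; the definition does not
require that there are no tails in between. -/
def IsRedRun (ω : ℕ → Bool) (N k a : ℕ) : Prop :=
  ∃ b ∈ Finset.Icc a N, ω a = true ∧ ω b = true ∧
    (∀ i ∈ Finset.Icc a b, ω i = true → IsRed ω N i) ∧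
    ((Finset.Icc a b).filter fun i => ω i = true).card = k

/-- The number of runs of `k` consecutive red heads (counted by their starting points, so runs may
overlap) when the first `N` tosses are made. -/
noncomputable def numRedRuns (ω : ℕ → Bool) (N k : ℕ) : ℕ := {a : ℕ | IsRedRun ω N k a}.ncard

/-- The length of the longest run of consecutive red heads when the first `N` tosses are made
(it is `0` if there is no red head). -/
noncomputable def longestRedRun (ω : ℕ → Bool) (N : ℕ) : ℕ := sSup {k : ℕ | ∃ a, IsRedRun ω N k a}

/-- The number of tosses that are made until `N` heads have come up
(it is `0` on the null event that this never happens). -/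
noncomputable def headTime (ω : ℕ → Bool) (N : ℕ) : ℕ := sInf {n : ℕ | heads ω n = N}

/-- The expected number of runs of `k` consecutive red heads among `N` tosses. -/
noncomputable def expectedRedRuns (p : unitInterval) (k N : ℕ) : ℝ :=
  ∫ ω, (numRedRuns ω N k : ℝ) ∂(tossMeasure p)

/-- The expected length of the longest run of consecutive red heads among `N` tosses. -/
noncomputable def expectedLongest (p : unitInterval) (N : ℕ) : ℝ :=
  ∫ ω, (longestRedRun ω N : ℝ) ∂(tossMeasure p)

/-- The expected length of the longest run of consecutive red heads among a total of `N` heads,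
that is, when the coin is tossed until `N` heads have come up. -/
noncomputable def expectedLongestHeads (p : unitInterval) (N : ℕ) : ℝ :=
  ∫ ω, (longestRedRun ω (headTime ω N) : ℝ) ∂(tossMeasure p)

/-- The probability that at least one run of `k` consecutive red heads occurs among `N` tosses. -/
noncomputable def probRedRun (p : unitInterval) (k N : ℕ) : ℝ :=
  (tossMeasure p).real {ω | ∃ a, IsRedRun ω N k a}

/-- To see a run of `k` red heads with reasonable probability one needs on the order of `x ^ k`
tosses, uniformly in `k ≥ 1`: for every `ε > 0` there are positive constants `c` and `C` such that
with at most `c * x ^ k` tosses the probability of such a run is at most `ε`, and with at least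
`C * x ^ k` tosses it is at least `1 - ε`. -/
def NeedsOrderTosses (p : unitInterval) (x : ℝ) : Prop :=
  ∀ ε : ℝ, 0 < ε → ∃ c C : ℝ, 0 < c ∧ 0 < C ∧ ∀ k : ℕ, 1 ≤ k → ∀ N : ℕ,
    ((N : ℝ) ≤ c * x ^ k → probRedRun p k N ≤ ε) ∧
    (C * x ^ k ≤ (N : ℝ) → 1 - ε ≤ probRedRun p k N)

end RedHeads

/-!
The second condition in the definition of a red head is automatic, because a head satisfies
`Δ_{i-1} < Δ_i`. So the `i`-th toss is a red head if and only if it is a head and the walk `Δ` stays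
at or above `Δ_i` up to the horizon. In particular a red head that is not the last toss is followed
by a head, and a run of `k` red heads is a block of `k` heads in consecutive tosses after which the
walk does not go below its value at the end of the block (`isRedRun_succ_iff`).

Read backwards from the horizon, such a block is a block of `k` heads that starts when the backward
walk is at a running maximum. The distance `deficit` of the backward walk to its running maximum is
a reflected random walk with drift towards `0`, and it is stochastically dominated by its geometric
stationary law with ratio `(1 - p) / p` (`integral_le_deficit_le`). Hence a block that starts at a
given toss is a red run with probability at least `p ^ k * (2 * p - 1) / p` (`le_prob_runAt`) and at
most `p ^ k` (`prob_runAt_le`); summation over the starting points gives the bounds for the expected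
number of runs.

By the union bound, `N` tosses contain a red run of length `k` with probability at most `N * p ^ k`.
In the other direction, the backward search for a block of `k` heads that starts at a running
maximum is a Markov chain, and `potential` is its expected remaining duration: it drops by one on
average in every step until the search succeeds (`potential_step`). Its initial value has
expectation at most a constant times `(1 / p) ^ k`, so the probability that the search is not
finished after `N` steps is at most `waitConst p * (1 / p) ^ k / N`
(`mul_prob_not_exists_runAt_le`). The search may start at any time, which means that redness may
refer to any horizon `M ≥ N` while the run is found among the first `N` tosses. This gives the order
of the number of tosses needed. When the coin is tossed until `N` heads have come up, the number of
tosses is at least `N`, and it is at most `M` with probability tending to `1` as `M → ∞`, so the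
same lower bound holds there (`mul_prob_longestRedRun_headTime_lt_le`); the upper bound is a union
bound over the starting points among the first `N` heads (`prob_le_longestRedRun_headTime_le`).

With these two-sided tail bounds, the sum of the tail probabilities, which is the expectation of the
longest run, differs from `log N / log (1 / p)` by a bounded amount (`abs_integral_sub_log_le`).
-/

namespace RedHeads

/-! ### Functions of finitely many tosses -/

instance (p : unitInterval) : IsProbabilityMeasure (tossMeasure p) := by
  unfold tossMeasure; infer_instance

lemma measurable_of_dependsOn {β : Type*} [MeasurableSpace β] {f : (ℕ → Bool) → β} {n : ℕ}
    (hf : DependsOn f (Set.Iic n)) : Measurable f := by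
  let ext : (Finset.Iic n → Bool) → ℕ → Bool :=
    fun x i => if h : i ∈ Finset.Iic n then x ⟨i, h⟩ else false
  have h : f = (fun x => f (ext x)) ∘ (Finset.Iic n).restrict := by
    funext ω
    refine hf fun i hi => ?_
    have : i ≤ n := hi
    simp [ext, this]
  rw [h]
  exact (measurable_of_finite _).comp (Finset.measurable_restrict _)

lemma integrable_of_dependsOn (p : unitInterval) {f : (ℕ → Bool) → ℝ} {n : ℕ}
    (hf : DependsOn f (Set.Iic n)) : Integrable f (tossMeasure p) := by
  let ext : (Finset.Iic n → Bool) → ℕ → Bool :=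
    fun x i => if h : i ∈ Finset.Iic n then x ⟨i, h⟩ else false
  have h : ∀ ω, f ω = f (ext ((Finset.Iic n).restrict ω)) := by
    intro ω
    refine hf fun i hi => ?_
    have : i ≤ n := hi
    simp [ext, this]
  refine Integrable.of_bound (measurable_of_dependsOn hf).aestronglyMeasurable
    (∑ x : Finset.Iic n → Bool, ‖f (ext x)‖) (Eventually.of_forall fun ω => ?_)
  rw [h ω]
  exact Finset.single_le_sum (f := fun x => ‖f (ext x)‖) (fun _ _ => norm_nonneg _)
    (Finset.mem_univ _)

lemma update_eq_of_dependsOn {β : Type*} {f : (ℕ → Bool) → β} {s : Set ℕ} (hf : DependsOn f s)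
    {i : ℕ} (hi : i ∉ s) (ω : ℕ → Bool) (b : Bool) : f (Function.update ω i b) = f ω :=
  hf fun j hj => Function.update_of_ne (fun h : j = i => hi (by rwa [← h])) b ω

lemma dependsOn_update {β : Type*} {f : (ℕ → Bool) → β} {s : Set ℕ} (hf : DependsOn f s)
    (i : ℕ) (b : Bool) : DependsOn (fun ω => f (Function.update ω i b)) s := by
  intro x y h
  refine hf fun j hj => ?_
  by_cases hji : j = i
  · subst hji; simp
  · simp [hji, h j hj]

lemma measurable_update_prod (i : ℕ) :
    Measurable fun x : (ℕ → Bool) × Bool => Function.update x.1 i x.2 := by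
  refine measurable_pi_lambda _ fun j => ?_
  by_cases hj : j = i
  · subst hj
    simpa using measurable_snd
  · simp only [Function.update_of_ne hj]
    exact (measurable_pi_apply j).comp measurable_fst

/-- Tossing one of the coins again does not change the law of the sequence. -/
lemma map_update_tossMeasure (p : unitInterval) (i : ℕ) :
    ((tossMeasure p).prod (ProbabilityTheory.bernoulliMeasure true false p)).map
      (fun x => Function.update x.1 i x.2) = tossMeasure p := by
  have hm := measurable_update_prod i
  refine Measure.eq_infinitePi _ fun s t ht => ?_
  rw [Measure.map_apply hm (MeasurableSet.pi s.countable_toSet fun j _ => ht j)]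
  have hpre : (fun x : (ℕ → Bool) × Bool => Function.update x.1 i x.2) ⁻¹' (Set.pi s t)
      = (Set.pi (s.erase i) t) ×ˢ (if i ∈ s then t i else Set.univ) := by
    ext ⟨ω, b⟩
    simp only [Set.mem_preimage, Set.mem_pi, Set.mem_prod, Finset.mem_coe, Finset.mem_erase]
    constructor
    · intro h
      refine ⟨fun j hj => by simpa [hj.1] using h j hj.2, ?_⟩
      split_ifs with his
      · simpa using h i his
      · trivial
    · rintro ⟨h1, h2⟩ j hj
      by_cases hji : j = i
      · subst hji; simpa [hj] using h2
      · simpa [hji] using h1 j ⟨hji, hj⟩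
  rw [hpre, Measure.prod_prod, tossMeasure, Measure.infinitePi_pi _ (fun j _ => ht j)]
  split_ifs with his
  · rw [mul_comm, Finset.mul_prod_erase s
      (fun j => (ProbabilityTheory.bernoulliMeasure true false p) (t j)) his]
  · rw [Finset.erase_eq_of_notMem his, measure_univ, mul_one]

/-- Averaging over the outcome of the `i`-th toss. -/
lemma integral_toss (p : unitInterval) {f : (ℕ → Bool) → ℝ} {n : ℕ}
    (hf : DependsOn f (Set.Iic n)) (i : ℕ) :
    ∫ ω, f ω ∂(tossMeasure p) =
      p * ∫ ω, f (Function.update ω i true) ∂(tossMeasure p) +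
      (1 - p) * ∫ ω, f (Function.update ω i false) ∂(tossMeasure p) := by
  have hm := measurable_update_prod i
  have hfi := integrable_of_dependsOn p hf
  have h1 : ∫ ω, f ω ∂(tossMeasure p) = ∫ x, f (Function.update x.1 i x.2)
      ∂((tossMeasure p).prod (ProbabilityTheory.bernoulliMeasure true false p)) := by
    conv_lhs => rw [← map_update_tossMeasure p i]
    exact integral_map hm.aemeasurable (measurable_of_dependsOn hf).aestronglyMeasurable
  have hint : Integrable (fun x : (ℕ → Bool) × Bool => f (Function.update x.1 i x.2))
      ((tossMeasure p).prod (ProbabilityTheory.bernoulliMeasure true false p)) := by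
    rw [← map_update_tossMeasure p i] at hfi
    exact hfi.comp_measurable hm
  rw [h1, integral_prod _ hint]
  have h2 : ∀ ω : ℕ → Bool, ∫ b, f (Function.update ω i b)
      ∂(ProbabilityTheory.bernoulliMeasure true false p)
      = p * f (Function.update ω i true) + (1 - p) * f (Function.update ω i false) := by
    intro ω
    rw [ProbabilityTheory.integral_bernoulliMeasure]
    simp
  simp_rw [h2]
  rw [integral_add, integral_const_mul, integral_const_mul]
  · exact (integrable_of_dependsOn p (dependsOn_update hf i true)).const_mul _
  · exact (integrable_of_dependsOn p (dependsOn_update hf i false)).const_mul _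

/-- A function of the tosses outside `T` is independent of the event that all tosses in `T` are
heads. -/
lemma integral_mul_prod_heads (p : unitInterval) {f : (ℕ → Bool) → ℝ} {n : ℕ} {s : Set ℕ}
    (hn : s ⊆ Set.Iic n) (hf : DependsOn f s) (T : Finset ℕ) (hT : ∀ i ∈ T, i ∉ s) :
    ∫ ω, f ω * ∏ i ∈ T, (if ω i = true then (1 : ℝ) else 0) ∂(tossMeasure p) =
      (p : ℝ) ^ T.card * ∫ ω, f ω ∂(tossMeasure p) := by
  induction T using Finset.induction_on with
  | empty => simp
  | insert a T ha ih =>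
    have hd : DependsOn (fun ω : ℕ → Bool =>
        f ω * ∏ i ∈ insert a T, (if ω i = true then (1 : ℝ) else 0))
        (Set.Iic (max n ((insert a T).sup id))) := by
      intro x y h
      have h1 : f x = f y := hf fun j hj => h j (le_trans (Set.mem_Iic.1 (hn hj)) (le_max_left _ _) :)
      have h2 : ∀ i ∈ insert a T, x i = y i := fun i hi =>
        h i (le_trans (Finset.le_sup (f := id) hi) (le_max_right _ _) :)
      simp only [h1]
      rw [Finset.prod_congr rfl fun i hi => by rw [h2 i hi]]
    rw [integral_toss p hd a, Finset.card_insert_of_notMem ha]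
    have hp : ∀ (ω : ℕ → Bool) (b : Bool),
        ∏ i ∈ insert a T, (if Function.update ω a b i = true then (1 : ℝ) else 0) =
        (if b = true then 1 else 0) * ∏ i ∈ T, (if ω i = true then (1 : ℝ) else 0) := by
      intro ω b
      rw [Finset.prod_insert ha, Function.update_self]
      congr 1
      refine Finset.prod_congr rfl fun i hi => ?_
      rw [Function.update_of_ne (fun h => ha (by rwa [h] at hi))]
    simp only [hp, update_eq_of_dependsOn hf (hT a (Finset.mem_insert_self a T))]
    simp only [if_true, one_mul, Bool.false_eq_true, if_false, zero_mul, mul_zero,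
      integral_zero, add_zero]
    rw [ih fun i hi => hT i (Finset.mem_insert_of_mem hi), pow_succ]
    ring

/-! ### Red runs as blocks of consecutive heads -/

lemma heads_succ (ω : ℕ → Bool) (i : ℕ) :
    heads ω (i + 1) = heads ω i + if ω (i + 1) = true then 1 else 0 := by
  simp only [heads, Finset.card_filter]
  exact Finset.sum_Icc_succ_top (by omega) _

lemma tails_succ (ω : ℕ → Bool) (i : ℕ) :
    tails ω (i + 1) = tails ω i + if ω (i + 1) = false then 1 else 0 := by
  simp only [tails, Finset.card_filter]
  exact Finset.sum_Icc_succ_top (by omega) _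

lemma Delta_succ (ω : ℕ → Bool) (i : ℕ) :
    Delta ω (i + 1) = Delta ω i + if ω (i + 1) = true then 1 else -1 := by
  rw [Delta, Delta, heads_succ, tails_succ]
  cases ω (i + 1) <;> simp <;> ring

lemma heads_zero (ω : ℕ → Bool) : heads ω 0 = 0 := by simp [heads]

lemma heads_le (ω : ℕ → Bool) (i : ℕ) : heads ω i ≤ i := by
  simpa [heads] using Finset.card_filter_le (Finset.Icc 1 i) fun j => ω j = true

lemma heads_mono (ω : ℕ → Bool) : Monotone (heads ω) :=
  monotone_nat_of_le_succ fun i => by rw [heads_succ]; omega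

lemma dependsOn_heads (i : ℕ) : DependsOn (fun ω => heads ω i) (Set.Iic i) := by
  intro x y h
  simp only [heads]
  congr 1
  exact Finset.filter_congr fun j hj => by rw [h j (Finset.mem_Icc.1 hj).2]

lemma dependsOn_Delta (i : ℕ) : DependsOn (fun ω => Delta ω i) (Set.Iic i) := by
  intro x y h
  have ht : tails x i = tails y i := by
    simp only [tails]
    congr 1
    exact Finset.filter_congr fun j hj => by rw [h j (Finset.mem_Icc.1 hj).2]
  have hh : heads x i = heads y i := dependsOn_heads i h
  simp only [Delta, ht, hh]

lemma Delta_add_of_heads {ω : ℕ → Bool} {c k : ℕ} (h : ∀ i ∈ Finset.Ioc c (c + k), ω i = true) :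
    Delta ω (c + k) = Delta ω c + k := by
  induction k with
  | zero => simp
  | succ k ih =>
    have h1 := ih fun i hi => h i (by simp only [Finset.mem_Ioc] at hi ⊢; omega)
    rw [← add_assoc, Delta_succ, h1, if_pos (h _ (by simp))]
    push_cast; ring

/-- The second condition in the definition of a red head always holds: as the `i`-th toss is a
head, `Δ_{i-1} < Δ_i`. -/
lemma isRed_iff {ω : ℕ → Bool} {N i : ℕ} :
    IsRed ω N i ↔ 1 ≤ i ∧ i ≤ N ∧ ω i = true ∧ ∀ j ∈ Finset.Icc i N, Delta ω i ≤ Delta ω j := by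
  constructor
  · rintro ⟨⟨h1, h2, h3⟩, h4, -⟩
    refine ⟨h1, h2, h3, fun j hj => ?_⟩
    rw [Finset.mem_Icc] at hj
    rcases hj.1.eq_or_lt with rfl | hlt
    · exact le_rfl
    · exact h4 j (Finset.mem_Icc.2 ⟨hlt, hj.2⟩)
  · rintro ⟨h1, h2, h3, h4⟩
    refine ⟨⟨h1, h2, h3⟩, fun j hj => h4 j ?_, fun k hk hle => ?_⟩
    · rw [Finset.mem_Icc] at hj ⊢; omega
    · obtain ⟨m, rfl⟩ : ∃ m, i = m + 1 := ⟨i - 1, by omega⟩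
      have hD := Delta_succ ω m
      rw [if_pos h3] at hD
      rw [Finset.mem_Ico] at hk
      have hne : k ≠ m := by rintro rfl; omega
      exact ⟨m, Finset.mem_Ioo.2 (by omega), by omega⟩

/-- The tosses `c + 1, …, c + k` are heads, and the walk `Δ` does not go below its value
`Δ_{c + k}` afterwards, up to the horizon `N`. -/
def RunAt (ω : ℕ → Bool) (N k c : ℕ) : Prop :=
  c + k ≤ N ∧ (∀ i ∈ Finset.Ioc c (c + k), ω i = true) ∧
    ∀ j ∈ Finset.Icc (c + k) N, Delta ω (c + k) ≤ Delta ω j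

/-- A red head that is not the last toss is followed by a head, so that the heads of a red run are
consecutive tosses; and a block of consecutive heads is red as soon as its last one is. -/
lemma isRedRun_succ_iff {ω : ℕ → Bool} {N k c : ℕ} (hk : 1 ≤ k) :
    IsRedRun ω N k (c + 1) ↔ RunAt ω N k c := by
  constructor
  · rintro ⟨b, hb, ha, -, hred, hcard⟩
    rw [Finset.mem_Icc] at hb
    have hall : ∀ i, c + 1 ≤ i → i ≤ b → ω i = true := by
      intro i hi
      induction i, hi using Nat.le_induction with
      | base => exact fun _ => ha
      | succ i hi ih =>
        intro hib
        obtain ⟨-, -, -, h⟩ := isRed_iff.1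
          (hred i (Finset.mem_Icc.2 ⟨hi, by omega⟩) (ih (by omega)))
        have h' := h (i + 1) (Finset.mem_Icc.2 (by omega))
        rw [Delta_succ] at h'
        by_contra hne
        rw [if_neg hne] at h'
        omega
    have hbk : b = c + k := by
      rw [Finset.filter_true_of_mem fun i hi => hall i (Finset.mem_Icc.1 hi).1
        (Finset.mem_Icc.1 hi).2, Nat.card_Icc] at hcard
      omega
    subst hbk
    refine ⟨hb.2, fun i hi => ?_, ?_⟩
    · rw [Finset.mem_Ioc] at hi
      exact hall i (by omega) hi.2
    · exact (isRed_iff.1 (hred _ (Finset.mem_Icc.2 ⟨hb.1, le_rfl⟩)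
        (hall _ hb.1 le_rfl))).2.2.2
  · rintro ⟨hN, hh, hD⟩
    have hh' : ∀ i ∈ Finset.Icc (c + 1) (c + k), ω i = true := fun i hi =>
      hh i (by rw [Finset.mem_Icc] at hi; rw [Finset.mem_Ioc]; omega)
    have hval : ∀ j ∈ Finset.Icc (c + 1) (c + k), Delta ω j = Delta ω c + (j - c : ℕ) := by
      intro j hj
      rw [Finset.mem_Icc] at hj
      have := Delta_add_of_heads (ω := ω) (c := c) (k := j - c) fun i hi =>
        hh i (by rw [Finset.mem_Ioc] at hi ⊢; omega)
      rwa [show c + (j - c) = j by omega] at this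
    refine ⟨c + k, Finset.mem_Icc.2 ⟨by omega, hN⟩, hh' _ (Finset.mem_Icc.2 (by omega)),
      hh' _ (Finset.mem_Icc.2 (by omega)), fun i hi hit => isRed_iff.2 ?_, ?_⟩
    · have hi' := Finset.mem_Icc.1 hi
      refine ⟨by omega, by omega, hit, fun j hj => ?_⟩
      rw [Finset.mem_Icc] at hj
      rcases le_total j (c + k) with hjk | hjk
      · have h1 := hval i hi
        have h2 := hval j (Finset.mem_Icc.2 (by omega))
        omega
      · have h1 := hval i hi
        have h2 := hval (c + k) (Finset.mem_Icc.2 (by omega))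
        have h3 := hD j (Finset.mem_Icc.2 ⟨hjk, hj.2⟩)
        omega
    · rw [Finset.filter_true_of_mem hh', Nat.card_Icc]
      omega

lemma IsRedRun.one_le {ω : ℕ → Bool} {N k a : ℕ} (h : IsRedRun ω N k a) : 1 ≤ a := by
  obtain ⟨b, hb, ha, -, hred, -⟩ := h
  exact (hred a (Finset.mem_Icc.2 ⟨le_rfl, (Finset.mem_Icc.1 hb).1⟩) ha).1.1

lemma IsRedRun.le_heads {ω : ℕ → Bool} {N k a : ℕ} (h : IsRedRun ω N k a) : k ≤ heads ω N := by
  have ha := h.one_le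
  obtain ⟨b, hb, -, -, -, rfl⟩ := h
  refine Finset.card_le_card (Finset.filter_subset_filter _ fun i hi => ?_)
  rw [Finset.mem_Icc] at hb hi ⊢
  omega

lemma exists_isRedRun_iff {ω : ℕ → Bool} {N k : ℕ} (hk : 1 ≤ k) :
    (∃ a, IsRedRun ω N k a) ↔ ∃ c, RunAt ω N k c := by
  constructor
  · rintro ⟨a, ha⟩
    obtain ⟨c, rfl⟩ : ∃ c, a = c + 1 := ⟨a - 1, by have := ha.one_le; omega⟩
    exact ⟨c, (isRedRun_succ_iff hk).1 ha⟩
  · rintro ⟨c, hc⟩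
    exact ⟨c + 1, (isRedRun_succ_iff hk).2 hc⟩

lemma RunAt.suffix {ω : ℕ → Bool} {N k m c : ℕ} (h : RunAt ω N m c) (hkm : k ≤ m) :
    RunAt ω N k (c + (m - k)) := by
  obtain ⟨h1, h2, h3⟩ := h
  have e : c + (m - k) + k = c + m := by omega
  refine ⟨by omega, fun i hi => h2 i ?_, ?_⟩
  · rw [e, Finset.mem_Ioc] at hi
    rw [Finset.mem_Ioc]
    omega
  · rwa [e]

lemma le_longestRedRun_iff {ω : ℕ → Bool} {N k : ℕ} (hk : 1 ≤ k) :
    k ≤ longestRedRun ω N ↔ ∃ c, RunAt ω N k c := by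
  have hbdd : BddAbove {k : ℕ | ∃ a, IsRedRun ω N k a} :=
    ⟨heads ω N, fun _ ⟨_, ha⟩ => ha.le_heads⟩
  constructor
  · intro h
    rw [longestRedRun] at h
    have hne : {k : ℕ | ∃ a, IsRedRun ω N k a}.Nonempty := by
      by_contra hem
      rw [Set.not_nonempty_iff_eq_empty.1 hem, csSup_empty] at h
      simp only [bot_eq_zero'] at h
      omega
    have hm := Nat.sSup_mem hne hbdd
    set m := sSup {k : ℕ | ∃ a, IsRedRun ω N k a}
    obtain ⟨c, hc⟩ := (exists_isRedRun_iff (hk.trans h)).1 hm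
    exact ⟨_, hc.suffix h⟩
  · intro h
    exact le_csSup hbdd ((exists_isRedRun_iff hk).2 h)

lemma longestRedRun_le_heads (ω : ℕ → Bool) (N : ℕ) : longestRedRun ω N ≤ heads ω N := by
  rcases Set.eq_empty_or_nonempty {k : ℕ | ∃ a, IsRedRun ω N k a} with h | h
  · simp [longestRedRun, h]
  · exact csSup_le h fun _ ⟨_, ha⟩ => ha.le_heads

lemma dependsOn_runAt (N k c : ℕ) : DependsOn (fun ω => RunAt ω N k c) (Set.Iic N) := by
  intro x y h
  simp only [RunAt]
  refine propext (and_congr_right fun hN => and_congr ?_ ?_)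
  · refine forall₂_congr fun i hi => ?_
    rw [h i ((Finset.mem_Ioc.1 hi).2.trans hN)]
  · refine forall₂_congr fun j hj => ?_
    have hD : ∀ i ≤ N, Delta x i = Delta y i := fun i hi =>
      dependsOn_Delta i fun l hl => h l (le_trans (Set.mem_Iic.1 hl) hi :)
    rw [hD _ hN, hD _ (Finset.mem_Icc.1 hj).2]

lemma dependsOn_longestRedRun (N : ℕ) :
    DependsOn (fun ω => longestRedRun ω N) (Set.Iic N) := by
  intro x y h
  refine eq_of_forall_le_iff fun k => ?_
  rcases Nat.eq_zero_or_pos k with rfl | hk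
  · simp
  · simp only [le_longestRedRun_iff hk]
    refine exists_congr fun c => ?_
    exact iff_of_eq (dependsOn_runAt N k c h)

/-- The starting points of red runs, counted one by one. -/
lemma numRedRuns_eq_sum {ω : ℕ → Bool} {N k : ℕ} (hk : 1 ≤ k) [∀ c, Decidable (RunAt ω N k c)] :
    numRedRuns ω N k = ∑ c ∈ Finset.range (N + 1 - k), if RunAt ω N k c then 1 else 0 := by
  rw [← Finset.card_filter, numRedRuns,
    ← Finset.card_image_of_injective _ (add_left_injective 1), ← Set.ncard_coe_finset]
  congr 1
  ext a
  simp only [Set.mem_ofPred_eq, Finset.coe_image, Finset.coe_filter, Finset.mem_range, Set.mem_image]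
  constructor
  · intro ha
    obtain ⟨c, rfl⟩ : ∃ c, a = c + 1 := ⟨a - 1, by have := ha.one_le; omega⟩
    have h := (isRedRun_succ_iff hk).1 ha
    exact ⟨c, ⟨by have := h.1; omega, h⟩, rfl⟩
  · rintro ⟨c, ⟨-, h⟩, rfl⟩
    exact (isRedRun_succ_iff hk).2 h

lemma geom_sum_le {x : ℝ} (hx0 : 0 ≤ x) (hx1 : x < 1) (n : ℕ) :
    ∑ i ∈ Finset.range n, x ^ i ≤ (1 - x)⁻¹ := by
  rw [← one_div, le_div_iff₀ (by linarith), geom_sum_mul_neg]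
  have := pow_nonneg hx0 n
  linarith

/-! ### The walk read backwards: its distance to the running maximum -/

/-- Read the tosses `M, M - 1, …` backwards. After `m` tosses, `deficit ω M m` is the distance of
the walk formed by them to its running maximum. It decreases by one (but not below zero) at a head
and increases by one at a tail. -/
def deficit (ω : ℕ → Bool) (M : ℕ) : ℕ → ℕ
  | 0 => 0
  | m + 1 => if ω (M - m) = true then deficit ω M m - 1 else deficit ω M m + 1

lemma deficit_succ (ω : ℕ → Bool) (M m : ℕ) : deficit ω M (m + 1) =
    if ω (M - m) = true then deficit ω M m - 1 else deficit ω M m + 1 := rfl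

lemma deficit_le (ω : ℕ → Bool) (M m : ℕ) : deficit ω M m ≤ m := by
  induction m with
  | zero => simp [deficit]
  | succ m ih => rw [deficit_succ]; split_ifs <;> omega

lemma dependsOn_deficit {M m : ℕ} (hm : m ≤ M) :
    DependsOn (fun ω => deficit ω M m) (Set.Ioc (M - m) M) := by
  induction m with
  | zero => intro x y _; rfl
  | succ m ih =>
    intro x y h
    have h1 : deficit x M m = deficit y M m := ih (by omega) fun i hi => h i (by
      rw [Set.mem_Ioc] at hi ⊢; omega)
    simp only [deficit_succ, h1, h (M - m) (by rw [Set.mem_Ioc]; omega)]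

lemma Delta_le_add_deficit (ω : ℕ → Bool) {M m : ℕ} (hm : m ≤ M) :
    ∀ j ∈ Finset.Icc (M - m) M, Delta ω (M - m) ≤ Delta ω j + deficit ω M m := by
  induction m with
  | zero =>
    intro j hj
    rw [Finset.mem_Icc] at hj
    obtain rfl : j = M := by omega
    simp [deficit]
  | succ m ih =>
    intro j hj
    rw [Finset.mem_Icc] at hj
    have hD := Delta_succ ω (M - (m + 1))
    rw [show M - (m + 1) + 1 = M - m by omega] at hD
    rw [deficit_succ]
    rcases hj.1.eq_or_lt with rfl | hlt
    · omega
    · have h1 := ih (by omega) j (Finset.mem_Icc.2 ⟨by omega, hj.2⟩)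
      split_ifs at hD ⊢ <;> omega

/-- The distance to the running maximum is dominated by its stationary law, which is geometric with
ratio `(1 - p) / p`. -/
lemma integral_le_deficit_le (p : unitInterval) (hp : 1 / 2 < (p : ℝ)) {M m : ℕ} (hm : m ≤ M)
    (j : ℕ) : ∫ ω, (if j ≤ deficit ω M m then (1 : ℝ) else 0) ∂(tossMeasure p) ≤
      ((1 - (p : ℝ)) / p) ^ j := by
  have hp0 : (0 : ℝ) < p := by linarith
  have hp1 : (p : ℝ) ≤ 1 := p.2.2
  induction m generalizing j with
  | zero =>
    rcases Nat.eq_zero_or_pos j with rfl | hj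
    · simp
    · simp only [deficit, Nat.le_zero, hj.ne', if_false, integral_zero]
      exact pow_nonneg (div_nonneg (by linarith) hp0.le) _
  | succ m ih =>
    rcases j with _ | j
    · simp
    have hd : ∀ l : ℕ, DependsOn
        (fun ω => if l ≤ deficit ω M m then (1 : ℝ) else 0) (Set.Ioc (M - m) M) := fun l x y h => by
      have h1 : deficit x M m = deficit y M m := dependsOn_deficit (by omega) h
      simp only [h1]
    have hd1 : DependsOn
        (fun ω => if j + 1 ≤ deficit ω M (m + 1) then (1 : ℝ) else 0) (Set.Iic M) := fun x y h => by
      have h1 : deficit x M (m + 1) = deficit y M (m + 1) :=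
        dependsOn_deficit hm fun i hi => h i hi.2
      simp only [h1]
    have hni : M - m ∉ Set.Ioc (M - m) M := by simp
    have e : ∀ (ω : ℕ → Bool) (b : Bool), deficit (Function.update ω (M - m) b) M m
        = deficit ω M m := update_eq_of_dependsOn (dependsOn_deficit (by omega)) hni
    have et : ∀ d : ℕ, (j + 1 ≤ d - 1) = (j + 2 ≤ d) := fun d => propext (by omega)
    have ef : ∀ d : ℕ, (j + 1 ≤ d + 1) = (j ≤ d) := fun d => propext (by omega)
    rw [integral_toss p hd1 (M - m)]
    simp only [deficit_succ, Function.update_self, e, if_true, Bool.false_eq_true, if_false, et, ef]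
    refine (add_le_add (mul_le_mul_of_nonneg_left (ih (by omega) (j + 2)) hp0.le)
      (mul_le_mul_of_nonneg_left (ih (by omega) j) (by linarith))).trans (le_of_eq ?_)
    simp only [pow_add]
    field_simp
    ring

lemma integral_deficit_le (p : unitInterval) (hp : 1 / 2 < (p : ℝ)) {M m : ℕ} (hm : m ≤ M) :
    ∫ ω, (deficit ω M m : ℝ) ∂(tossMeasure p) ≤ (p : ℝ) / (2 * p - 1) := by
  have hp0 : (0 : ℝ) < p := by linarith
  have hp1 : (p : ℝ) ≤ 1 := p.2.2
  have hr0 : 0 ≤ (1 - (p : ℝ)) / p := div_nonneg (by linarith) hp0.le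
  have hr1 : (1 - (p : ℝ)) / p < 1 := by rw [div_lt_one hp0]; linarith
  have hsum : ∀ ω, (deficit ω M m : ℝ) =
      ∑ j ∈ Finset.range m, if j + 1 ≤ deficit ω M m then (1 : ℝ) else 0 := by
    intro ω
    rw [← Finset.sum_filter, Finset.sum_const, nsmul_eq_mul, mul_one]
    congr 1
    have : (Finset.range m).filter (fun j => j + 1 ≤ deficit ω M m)
        = Finset.range (deficit ω M m) := by
      ext j
      have := deficit_le ω M m
      simp only [Finset.mem_filter, Finset.mem_range]
      omega
    rw [this, Finset.card_range]
  simp_rw [hsum]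
  rw [integral_finsetSum]
  · calc _ ≤ ∑ j ∈ Finset.range m, ((1 - (p : ℝ)) / p) ^ (j + 1) :=
        Finset.sum_le_sum fun j _ => integral_le_deficit_le p hp hm (j + 1)
      _ ≤ ∑ j ∈ Finset.range m, ((1 - (p : ℝ)) / p) ^ j :=
        Finset.sum_le_sum fun j _ => pow_le_pow_of_le_one hr0 hr1.le (Nat.le_succ j)
      _ ≤ (1 - (1 - (p : ℝ)) / p)⁻¹ := geom_sum_le hr0 hr1 m
      _ = (p : ℝ) / (2 * p - 1) := by
        rw [one_sub_div hp0.ne', inv_div]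
        ring_nf
  · intro j _
    refine integrable_of_dependsOn p (n := M) fun x y h => ?_
    have h1 : deficit x M m = deficit y M m := dependsOn_deficit hm fun i hi => h i hi.2
    simp only [h1]

/-! ### The waiting time for a red run, going backwards -/

/-- One step of the backward search for a block of `k` heads that starts at a running maximum. The
state `(d, s)` holds the distance `d` to the running maximum and the length `s` of the current block
of consecutive heads, counted from the moment when the walk reached its running maximum again
(`s = 0` if `d ≠ 0`). The search stops when `s = k`. -/
def runStep (k : ℕ) (x : ℕ × ℕ) (b : Bool) : ℕ × ℕ :=
  if x.2 = k then x
  else if b = true then (if x.1 = 0 then (0, x.2 + 1) else (x.1 - 1, 0))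
  else (x.1 + 1, 0)

/-- The backward search for a block of `k` heads that is red with respect to the horizon `M`; it
reads the tosses `N, N - 1, …`, after the distance to the running maximum has been computed from the
tosses `M, …, N + 1`. -/
def runChain (ω : ℕ → Bool) (M N k : ℕ) : ℕ → ℕ × ℕ
  | 0 => (deficit ω M (M - N), 0)
  | n + 1 => runStep k (runChain ω M N k n) (ω (N - n))

lemma runChain_succ (ω : ℕ → Bool) (M N k n : ℕ) :
    runChain ω M N k (n + 1) = runStep k (runChain ω M N k n) (ω (N - n)) := rfl

lemma dependsOn_runChain {M N : ℕ} (hNM : N ≤ M) (k : ℕ) {n : ℕ} (hn : n ≤ N) :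
    DependsOn (fun ω => runChain ω M N k n) (Set.Ioc (N - n) M) := by
  induction n with
  | zero =>
    intro x y h
    have h1 : deficit x M (M - N) = deficit y M (M - N) :=
      dependsOn_deficit (by omega) fun i hi => h i (by rw [Set.mem_Ioc] at hi ⊢; omega)
    simp only [runChain, h1]
  | succ n ih =>
    intro x y h
    have h1 : runChain x M N k n = runChain y M N k n := ih (by omega) fun i hi => h i (by
      rw [Set.mem_Ioc] at hi ⊢; omega)
    simp only [runChain_succ, h1, h (N - n) (by rw [Set.mem_Ioc]; omega)]

lemma runChain_snd_le (ω : ℕ → Bool) (M N k n : ℕ) :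
    (runChain ω M N k n).2 ≤ k ∧ (0 < (runChain ω M N k n).2 → (runChain ω M N k n).1 = 0) := by
  induction n with
  | zero => simp [runChain]
  | succ n ih =>
    rw [runChain_succ, runStep]
    split_ifs <;> (simp_all; try omega)

lemma exists_runAt_of_runChain (ω : ℕ → Bool) {M N k : ℕ} (hNM : N ≤ M) (hk : 1 ≤ k)
    (h : (runChain ω M N k N).2 = k) : ∃ c, c + k ≤ N ∧ RunAt ω M k c := by
  -- Invariant of the search: either the block has been found, or the state describes the tosses
  -- seen so far.
  have key : ∀ n ≤ N, (∃ c, c + k ≤ N ∧ RunAt ω M k c) ∨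
      ((runChain ω M N k n).2 < k ∧ N - n + (runChain ω M N k n).2 ≤ N ∧
      (∀ j ∈ Finset.Icc (N - n) M, Delta ω (N - n) ≤ Delta ω j + (runChain ω M N k n).1) ∧
      (∀ i ∈ Finset.Ioc (N - n) (N - n + (runChain ω M N k n).2), ω i = true) ∧
      (0 < (runChain ω M N k n).2 → ∀ j ∈ Finset.Icc (N - n + (runChain ω M N k n).2) M,
        Delta ω (N - n + (runChain ω M N k n).2) ≤ Delta ω j)) := by
    intro n hn
    induction n with
    | zero =>
      right
      refine ⟨hk, le_rfl, ?_, by simp [runChain], by simp [runChain]⟩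
      have := Delta_le_add_deficit ω (M := M) (m := M - N) (by omega)
      rwa [show M - (M - N) = N - 0 by omega] at this
    | succ n ih =>
      rcases ih (by omega) with hl | ⟨h1, h2, h3, h4, h5⟩
      · exact Or.inl hl
      have h6 := (runChain_snd_le ω M N k n).2
      rw [runChain_succ]
      generalize runChain ω M N k n = x at h1 h2 h3 h4 h5 h6
      obtain ⟨d, s⟩ := x
      simp only at h1 h2 h3 h4 h5 h6
      obtain ⟨q, hq⟩ : ∃ q, N - (n + 1) = q := ⟨_, rfl⟩
      have hq' : N - n = q + 1 := by omega
      have hD := Delta_succ ω q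
      rw [hq'] at h2 h3 h4 h5
      rw [hq, hq', runStep, if_neg h1.ne]
      by_cases hb : ω (q + 1) = true
      · rw [if_pos hb] at hD ⊢
        by_cases hd : d = 0
        · subst hd
          simp only [if_true]
          have hB : ∀ i ∈ Finset.Ioc q (q + (s + 1)), ω i = true := by
            intro i hi
            rw [Finset.mem_Ioc] at hi
            rcases (Nat.succ_le_of_lt hi.1).eq_or_lt with rfl | hlt
            · exact hb
            · exact h4 i (Finset.mem_Ioc.2 ⟨hlt, by omega⟩)
          have hC : ∀ j ∈ Finset.Icc (q + (s + 1)) M, Delta ω (q + (s + 1)) ≤ Delta ω j := by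
            rw [show q + (s + 1) = q + 1 + s by omega]
            rcases Nat.eq_zero_or_pos s with rfl | hs
            · simpa using h3
            · exact h5 hs
          rcases (Nat.succ_le_of_lt h1).eq_or_lt with hsk | hsk
          · left
            have hsk' : s + 1 = k := hsk
            rw [hsk'] at hB hC
            exact ⟨q, by omega, by omega, hB, hC⟩
          · right
            refine ⟨hsk, by omega, ?_, hB, fun _ => hC⟩
            intro j hj
            rw [Finset.mem_Icc] at hj
            rcases hj.1.eq_or_lt with rfl | hlt
            · simp
            · have := h3 j (Finset.mem_Icc.2 ⟨hlt, hj.2⟩)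
              omega
        · right
          simp only [hd, if_false]
          refine ⟨by omega, by omega, ?_, by simp, by simp⟩
          intro j hj
          rw [Finset.mem_Icc] at hj
          rcases hj.1.eq_or_lt with rfl | hlt
          · omega
          · have := h3 j (Finset.mem_Icc.2 ⟨hlt, hj.2⟩)
            omega
      · right
        rw [if_neg hb] at hD ⊢
        refine ⟨by simp; omega, by simp; omega, ?_, by simp, by simp⟩
        intro j hj
        simp only
        rw [Finset.mem_Icc] at hj
        rcases hj.1.eq_or_lt with rfl | hlt
        · omega
        · have := h3 j (Finset.mem_Icc.2 ⟨hlt, hj.2⟩)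
          omega
  rcases key N le_rfl with hl | hr
  · exact hl
  · omega

/-- The expected number of further steps of the backward search from a state `x = (d, s)` with
`s ≤ k`, and with `s = 0` if `d ≠ 0`. -/
noncomputable def potential (p : ℝ) (k : ℕ) (x : ℕ × ℕ) : ℝ :=
  x.1 / (2 * p - 1) + p / ((1 - p) * (2 * p - 1)) * ((1 / p) ^ k - (1 / p) ^ x.2)

lemma potential_nonneg {p : ℝ} (hp : 1 / 2 < p) (hp1 : p < 1) {k : ℕ} {x : ℕ × ℕ}
    (hx : x.2 ≤ k) : 0 ≤ potential p k x := by
  have h1 : (0 : ℝ) < 2 * p - 1 := by linarith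
  have h2 : (0 : ℝ) < 1 - p := by linarith
  have h3 : (1 / p) ^ x.2 ≤ (1 / p) ^ k :=
    pow_le_pow_right₀ (by rw [le_div_iff₀ (by linarith)]; linarith) hx
  have h4 : (0 : ℝ) < p := by linarith
  have h5 : 0 ≤ (1 / p) ^ k - (1 / p) ^ x.2 := by linarith
  rw [potential]
  positivity

lemma potential_step {p : ℝ} (hp : 1 / 2 < p) (hp1 : p < 1) {k : ℕ} {x : ℕ × ℕ}
    (hx : 0 < x.2 → x.1 = 0) :
    p * potential p k (runStep k x true) + (1 - p) * potential p k (runStep k x false) =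
      potential p k x - if x.2 = k then 0 else 1 := by
  have h1 : p * 2 - 1 ≠ 0 := by linarith
  have h2 : 1 - p ≠ 0 := by linarith
  have h4 : p ≠ 0 := by linarith
  obtain ⟨d, s⟩ := x
  simp only at hx
  by_cases hs : s = k
  · simp only [runStep, hs, if_true]
    ring
  · rcases Nat.eq_zero_or_pos d with rfl | hd
    · simp only [runStep, hs, if_true, if_false, Bool.false_eq_true, potential, pow_succ]
      generalize (1 / p) ^ s = u
      generalize (1 / p) ^ k = v
      push_cast
      field_simp
      ring
    · obtain rfl : s = 0 := by
        by_contra h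
        have := hx (Nat.pos_of_ne_zero h)
        omega
      obtain ⟨e, rfl⟩ : ∃ e, d = e + 1 := ⟨d - 1, by omega⟩
      simp only [runStep, hs, if_true, if_false, Bool.false_eq_true, potential, Nat.succ_ne_zero,
        Nat.add_sub_cancel]
      generalize (1 / p) ^ k = v
      push_cast
      field_simp
      ring

/-- Markov's inequality for the duration of the backward search, whose expectation is at most that
of the initial potential. -/
lemma mul_integral_not_found_le (p : unitInterval) (hp : 1 / 2 < (p : ℝ)) (hp1 : (p : ℝ) < 1)
    {M N k : ℕ} (hNM : N ≤ M) :
    N * ∫ ω, (if (runChain ω M N k N).2 = k then (0 : ℝ) else 1) ∂(tossMeasure p) ≤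
      ∫ ω, potential p k (runChain ω M N k 0) ∂(tossMeasure p) := by
  have hdep : ∀ (g : ℕ × ℕ → ℝ) (n : ℕ), n ≤ N →
      DependsOn (fun ω => g (runChain ω M N k n)) (Set.Iic M) := fun g n hn x y h => by
    have h1 : runChain x M N k n = runChain y M N k n :=
      dependsOn_runChain hNM k hn fun i hi => h i hi.2
    simp only [h1]
  have hint : ∀ (g : ℕ × ℕ → ℝ) (n : ℕ), n ≤ N →
      Integrable (fun ω => g (runChain ω M N k n)) (tossMeasure p) := fun g n hn =>
    integrable_of_dependsOn p (hdep g n hn)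
  have hstep : ∀ n, n + 1 ≤ N →
      ∫ ω, potential p k (runChain ω M N k (n + 1)) ∂(tossMeasure p) =
      ∫ ω, potential p k (runChain ω M N k n) ∂(tossMeasure p) -
        ∫ ω, (if (runChain ω M N k n).2 = k then (0 : ℝ) else 1) ∂(tossMeasure p) := by
    intro n hn
    have e : ∀ (ω : ℕ → Bool) (b : Bool), runChain (Function.update ω (N - n) b) M N k n
        = runChain ω M N k n :=
      update_eq_of_dependsOn (dependsOn_runChain hNM k (by omega)) (by simp)
    rw [integral_toss p (hdep _ (n + 1) hn) (N - n)]
    simp only [runChain_succ, Function.update_self, e]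
    rw [← integral_const_mul, ← integral_const_mul, ← integral_add, ← integral_sub]
    · refine integral_congr_ae (Eventually.of_forall fun ω => ?_)
      exact potential_step hp hp1 (runChain_snd_le ω M N k n).2
    · exact hint _ n (by omega)
    · exact hint (fun x => if x.2 = k then (0 : ℝ) else 1) n (by omega)
    · exact (hint (fun x => potential p k (runStep k x true)) n (by omega)).const_mul _
    · exact (hint (fun x => potential p k (runStep k x false)) n (by omega)).const_mul _
  have hmono : ∀ n, n + 1 ≤ N →
      ∫ ω, (if (runChain ω M N k (n + 1)).2 = k then (0 : ℝ) else 1) ∂(tossMeasure p) ≤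
      ∫ ω, (if (runChain ω M N k n).2 = k then (0 : ℝ) else 1) ∂(tossMeasure p) := by
    intro n hn
    refine integral_mono (hint (fun x => if x.2 = k then (0 : ℝ) else 1) _ hn)
      (hint (fun x => if x.2 = k then (0 : ℝ) else 1) _ (by omega)) fun ω => ?_
    simp only [runChain_succ, runStep]
    split_ifs <;> simp_all
  have hsum : ∀ n ≤ N, n * ∫ ω, (if (runChain ω M N k n).2 = k then (0 : ℝ) else 1)
      ∂(tossMeasure p) + ∫ ω, potential p k (runChain ω M N k n) ∂(tossMeasure p) ≤
      ∫ ω, potential p k (runChain ω M N k 0) ∂(tossMeasure p) := by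
    intro n hn
    induction n with
    | zero => simp
    | succ n ih =>
      have h1 := ih (by omega)
      have h2 := hstep n hn
      have h3 := mul_le_mul_of_nonneg_left (hmono n hn) (Nat.cast_nonneg (α := ℝ) (n + 1))
      push_cast at h3 ⊢
      linarith
  have hnn : 0 ≤ ∫ ω, potential p k (runChain ω M N k N) ∂(tossMeasure p) :=
    integral_nonneg fun ω => potential_nonneg hp hp1 (runChain_snd_le ω M N k N).1
  linarith [hsum N le_rfl]

/-- The constant in the bound `waitConst p * (1 / p) ^ k` for the expected time that the backward
search for a red run of length `k` takes. -/
noncomputable def waitConst (p : ℝ) : ℝ :=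
  p / (2 * p - 1) / (2 * p - 1) + p / ((1 - p) * (2 * p - 1))

lemma waitConst_pos {p : ℝ} (hp : 1 / 2 < p) (hp1 : p < 1) : 0 < waitConst p := by
  have h1 : (0 : ℝ) < 2 * p - 1 := by linarith
  have h2 : (0 : ℝ) < 1 - p := by linarith
  have h4 : (0 : ℝ) < p := by linarith
  rw [waitConst]
  positivity

/-- Among the first `N` tosses there is, with high probability, a run of `k` heads that are red with
respect to the horizon `M`; the bound does not depend on `M`. -/
lemma mul_prob_not_exists_runAt_le (p : unitInterval) (hp : 1 / 2 < (p : ℝ)) (hp1 : (p : ℝ) < 1)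
    {M N k : ℕ} (hNM : N ≤ M) (hk : 1 ≤ k) :
    N * (tossMeasure p).real {ω | ¬ ∃ c, c + k ≤ N ∧ RunAt ω M k c} ≤
      waitConst p * (1 / (p : ℝ)) ^ k := by
  have h1 : (0 : ℝ) < 2 * p - 1 := by linarith
  have h2 : (0 : ℝ) < 1 - p := by linarith
  have h4 : (0 : ℝ) < p := by linarith
  have hone : (1 : ℝ) ≤ (1 / p) ^ k := one_le_pow₀ (by rw [le_div_iff₀ h4]; linarith)
  have hms : MeasurableSet {ω : ℕ → Bool | (runChain ω M N k N).2 ≠ k} := by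
    refine measurable_of_dependsOn (β := Prop) (n := M)
      (f := fun ω => (runChain ω M N k N).2 ≠ k) (fun x y h => ?_) |>.setOf
    have h1 : runChain x M N k N = runChain y M N k N :=
      dependsOn_runChain hNM k le_rfl fun i hi => h i hi.2
    simp only [h1]
  have hle : (tossMeasure p).real {ω | ¬ ∃ c, c + k ≤ N ∧ RunAt ω M k c} ≤
      ∫ ω, (if (runChain ω M N k N).2 = k then (0 : ℝ) else 1) ∂(tossMeasure p) := by
    refine (measureReal_mono (s₂ := {ω | (runChain ω M N k N).2 ≠ k}) fun ω hω => ?_).trans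
      (le_of_eq ?_)
    · rw [Set.mem_ofPred_eq] at hω ⊢
      exact fun hf => hω (exists_runAt_of_runChain ω hNM hk hf)
    rw [← integral_indicator_one hms]
    refine integral_congr_ae (Eventually.of_forall fun ω => ?_)
    by_cases h : (runChain ω M N k N).2 = k <;> simp [Set.indicator, h]
  refine (mul_le_mul_of_nonneg_left hle (Nat.cast_nonneg N)).trans
    ((mul_integral_not_found_le p hp hp1 hNM).trans ?_)
  have hd : DependsOn (fun ω => (deficit ω M (M - N) : ℝ)) (Set.Iic M) := fun x y h => by
    have h1 : deficit x M (M - N) = deficit y M (M - N) :=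
      dependsOn_deficit (by omega) fun i hi => h i hi.2
    simp only [h1]
  have hi := integrable_of_dependsOn p hd
  simp only [potential, runChain, pow_zero]
  rw [integral_add (hi.div_const _) (integrable_const _), integral_div, integral_const,
    probReal_univ, one_smul]
  have h5 := div_le_div_of_nonneg_right (integral_deficit_le p hp (M := M) (m := M - N)
    (by omega)) h1.le
  have h6 : 0 ≤ (p : ℝ) / (2 * p - 1) / (2 * p - 1) := by positivity
  have h7 : 0 ≤ (p : ℝ) / ((1 - p) * (2 * p - 1)) := by positivity
  rw [waitConst]
  nlinarith [mul_nonneg h6 (sub_nonneg.2 hone)]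

/-! ### Probabilities of single red runs -/

lemma measurableSet_of_dependsOn {A : (ℕ → Bool) → Prop} {n : ℕ}
    (hA : DependsOn A (Set.Iic n)) : MeasurableSet {ω | A ω} :=
  (measurable_of_dependsOn hA).setOf

lemma integral_ite_eq_prob (p : unitInterval) {A : (ℕ → Bool) → Prop} [DecidablePred A]
    (hA : MeasurableSet {ω | A ω}) :
    ∫ ω, (if A ω then (1 : ℝ) else 0) ∂(tossMeasure p) = (tossMeasure p).real {ω | A ω} := by
  rw [← integral_indicator_one hA]
  refine integral_congr_ae (Eventually.of_forall fun ω => ?_)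
  by_cases h : A ω <;> simp [Set.indicator, h]

lemma integrable_ite (p : unitInterval) {A : (ℕ → Bool) → Prop} [DecidablePred A]
    (hA : MeasurableSet {ω | A ω}) :
    Integrable (fun ω => if A ω then (1 : ℝ) else 0) (tossMeasure p) := by
  refine Integrable.of_bound (C := 1) (Measurable.ite hA measurable_const
    measurable_const).aestronglyMeasurable (Eventually.of_forall fun ω => ?_)
  split_ifs <;> simp

lemma prob_and_heads (p : unitInterval) {A : (ℕ → Bool) → Prop} {n : ℕ} {s : Set ℕ}
    (hn : s ⊆ Set.Iic n) (hA : DependsOn A s) (T : Finset ℕ) (hT : ∀ i ∈ T, i ∉ s) :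
    (tossMeasure p).real {ω | A ω ∧ ∀ i ∈ T, ω i = true} =
      (p : ℝ) ^ T.card * (tossMeasure p).real {ω | A ω} := by
  classical
  have hm : MeasurableSet {ω : ℕ → Bool | A ω ∧ ∀ i ∈ T, ω i = true} := by
    refine measurableSet_of_dependsOn (n := max n (T.sup id)) fun x y h => ?_
    have h1 : A x = A y := hA fun j hj => h j (le_trans (Set.mem_Iic.1 (hn hj)) (le_max_left _ _) :)
    have h2 : ∀ i ∈ T, x i = y i := fun i hi =>
      h i (le_trans (Finset.le_sup (f := id) hi) (le_max_right _ _) :)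
    rw [h1]
    exact propext (and_congr_right fun _ => forall₂_congr fun i hi => by rw [h2 i hi])
  rw [← integral_ite_eq_prob p hm, ← integral_ite_eq_prob p (measurableSet_of_dependsOn
    (hA.mono hn)), ← integral_mul_prod_heads p (f := fun ω => if A ω then (1 : ℝ) else 0) hn
    (fun x y h => by simp only [hA h]) T hT]
  refine integral_congr_ae (Eventually.of_forall fun ω => ?_)
  simp only
  rw [Finset.prod_ite_zero]
  by_cases h1 : A ω <;> by_cases h2 : ∀ i ∈ T, ω i = true <;> simp [h1, h2]

lemma prob_heads (p : unitInterval) (T : Finset ℕ) :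
    (tossMeasure p).real {ω | ∀ i ∈ T, ω i = true} = (p : ℝ) ^ T.card := by
  have h := prob_and_heads p (A := fun _ => True) (n := 0) (s := ∅) (by simp)
    (fun _ _ _ => rfl) T (by simp)
  simpa using h

lemma prob_runAt_le (p : unitInterval) (N k c : ℕ) :
    (tossMeasure p).real {ω | RunAt ω N k c} ≤ (p : ℝ) ^ k := by
  have h := prob_heads p (Finset.Ioc c (c + k))
  rw [Nat.card_Ioc, Nat.add_sub_cancel_left] at h
  rw [← h]
  exact measureReal_mono fun ω hω => hω.2.1

lemma le_prob_runAt (p : unitInterval) (hp : 1 / 2 < (p : ℝ)) {N k c : ℕ} (h : c + k ≤ N) :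
    (p : ℝ) ^ k * ((2 * p - 1) / p) ≤ (tossMeasure p).real {ω | RunAt ω N k c} := by
  have hp0 : (0 : ℝ) < p := by linarith
  have hsub : Set.Ioc (c + k) N ⊆ Set.Iic N := fun i hi => hi.2
  have e : N - (N - (c + k)) = c + k := by omega
  have hd : DependsOn (fun ω => deficit ω N (N - (c + k))) (Set.Ioc (c + k) N) := by
    have := dependsOn_deficit (M := N) (m := N - (c + k)) (by omega)
    rwa [e] at this
  have hA : DependsOn (fun ω => ¬ 1 ≤ deficit ω N (N - (c + k))) (Set.Ioc (c + k) N) :=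
    fun x y h => by
      have h1 : deficit x N (N - (c + k)) = deficit y N (N - (c + k)) := hd h
      simp only [h1]
  have hA' : DependsOn (fun ω => 1 ≤ deficit ω N (N - (c + k))) (Set.Ioc (c + k) N) :=
    fun x y h => by
      have h1 : deficit x N (N - (c + k)) = deficit y N (N - (c + k)) := hd h
      simp only [h1]
  have h1 := prob_and_heads p hsub hA (Finset.Ioc c (c + k)) fun i hi hi' => by
    rw [Finset.mem_Ioc] at hi
    exact absurd hi'.1 (by omega)
  rw [Nat.card_Ioc, Nat.add_sub_cancel_left] at h1
  have h2 := integral_le_deficit_le p hp (M := N) (m := N - (c + k)) (by omega) 1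
  have hms := measurableSet_of_dependsOn (hA'.mono hsub)
  rw [integral_ite_eq_prob p hms, pow_one] at h2
  have h3 : (tossMeasure p).real {ω | ¬ 1 ≤ deficit ω N (N - (c + k))} =
      1 - (tossMeasure p).real {ω | 1 ≤ deficit ω N (N - (c + k))} :=
    probReal_compl_eq_one_sub hms
  have h4 : ((2 * p - 1) / p : ℝ) = 1 - (1 - p) / p := by field_simp; ring
  refine le_trans (mul_le_mul_of_nonneg_left (?_ : _ ≤ _) (pow_nonneg hp0.le k))
    (h1.symm.le.trans (measureReal_mono fun ω hω => ?_))
  · rw [h4, h3]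
    linarith
  · obtain ⟨h5, h6⟩ := hω
    refine ⟨h, h6, ?_⟩
    have h7 := Delta_le_add_deficit ω (M := N) (m := N - (c + k)) (by omega)
    rw [e] at h7
    intro j hj
    have := h7 j hj
    omega

/-! ### The longest red run among `N` tosses -/

lemma prob_exists_isRedRun_le (p : unitInterval) {k : ℕ} (hk : 1 ≤ k) (N : ℕ) :
    probRedRun p k N ≤ N * (p : ℝ) ^ k := by
  have hsub : {ω | ∃ a, IsRedRun ω N k a} ⊆
      ⋃ c ∈ Finset.range N, {ω | RunAt ω N k c} := by
    intro ω hω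
    obtain ⟨c, hc⟩ := (exists_isRedRun_iff hk).1 hω
    have := hc.1
    exact Set.mem_biUnion (x := c) (by simp; omega) hc
  calc probRedRun p k N ≤ (tossMeasure p).real (⋃ c ∈ Finset.range N, {ω | RunAt ω N k c}) :=
        measureReal_mono hsub (measure_ne_top _ _)
    _ ≤ ∑ c ∈ Finset.range N, (tossMeasure p).real {ω | RunAt ω N k c} :=
        measureReal_biUnion_finset_le _ _
    _ ≤ ∑ c ∈ Finset.range N, (p : ℝ) ^ k :=
        Finset.sum_le_sum fun c _ => prob_runAt_le p N k c
    _ = N * (p : ℝ) ^ k := by simp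

lemma prob_le_longestRedRun (p : unitInterval) {k : ℕ} (hk : 1 ≤ k) (N : ℕ) :
    (tossMeasure p).real {ω | k ≤ longestRedRun ω N} = probRedRun p k N := by
  simp only [probRedRun, le_longestRedRun_iff hk, exists_isRedRun_iff hk]

lemma mul_prob_longestRedRun_lt_le (p : unitInterval) (hp : 1 / 2 < (p : ℝ)) (hp1 : (p : ℝ) < 1)
    {k : ℕ} (hk : 1 ≤ k) (N : ℕ) :
    N * (tossMeasure p).real {ω | ¬ k ≤ longestRedRun ω N} ≤
      waitConst p * (1 / (p : ℝ)) ^ k := by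
  refine le_trans (mul_le_mul_of_nonneg_left (measureReal_mono fun ω hω => ?_)
    (Nat.cast_nonneg N)) (mul_prob_not_exists_runAt_le p hp hp1 (le_refl N) hk)
  rw [Set.mem_ofPred_eq] at hω ⊢
  rintro ⟨c, -, hc⟩
  exact hω ((le_longestRedRun_iff hk).2 ⟨c, hc⟩)

/-! ### The longest red run among `N` heads -/

lemma exists_heads_eq {ω : ℕ → Bool} {M N : ℕ} (h : N ≤ heads ω M) :
    ∃ n ≤ M, heads ω n = N := by
  induction M with
  | zero => exact ⟨0, le_rfl, by rw [heads_zero] at h ⊢; omega⟩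
  | succ M ih =>
    by_cases hM : N ≤ heads ω M
    · obtain ⟨n, hn, hn'⟩ := ih hM
      exact ⟨n, hn.trans (Nat.le_succ M), hn'⟩
    · refine ⟨M + 1, le_rfl, ?_⟩
      rw [heads_succ] at h ⊢
      split_ifs at h ⊢ <;> omega

lemma heads_headTime {ω : ℕ → Bool} {n N : ℕ} (h : heads ω n = N) :
    heads ω (headTime ω N) = N :=
  Nat.sInf_mem (s := {n | heads ω n = N}) ⟨n, h⟩

lemma heads_headTime_le (ω : ℕ → Bool) (N : ℕ) : heads ω (headTime ω N) ≤ N := by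
  by_cases h : ∃ n, heads ω n = N
  · obtain ⟨n, hn⟩ := h
    exact (heads_headTime hn).le
  · have : {n | heads ω n = N} = ∅ := by
      ext n
      simpa using fun hn => h ⟨n, hn⟩
    rw [headTime, this, Nat.sInf_empty, heads_zero]
    exact Nat.zero_le N

lemma measurable_headTime (N : ℕ) : Measurable fun ω => headTime ω N := by
  refine measurable_to_countable' fun n => ?_
  have hm : ∀ m, MeasurableSet {ω : ℕ → Bool | heads ω m = N} := fun m =>
    measurableSet_of_dependsOn (n := m) fun x y h => by
      have h1 : heads x m = heads y m := dependsOn_heads m h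
      simp only [h1]
  have he : (fun ω => headTime ω N) ⁻¹' {n} =
      ({ω | heads ω n = N} ∩ ⋂ m : Fin n, {ω | heads ω m = N}ᶜ) ∪
      ((⋂ m, {ω | heads ω m = N}ᶜ) ∩ {_ω | n = 0}) := by
    ext ω
    simp only [Set.mem_preimage, Set.mem_singleton_iff, Set.mem_union, Set.mem_inter_iff,
      Set.mem_iInter, Set.mem_compl_iff, Set.mem_ofPred_eq]
    constructor
    · rintro rfl
      by_cases h : ∃ n, heads ω n = N
      · obtain ⟨n, hn⟩ := h
        exact Or.inl ⟨heads_headTime hn, fun m hm' =>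
          absurd (Nat.sInf_le (s := {n | heads ω n = N}) hm') (not_le.2 m.2)⟩
      · refine Or.inr ⟨fun m hm' => h ⟨m, hm'⟩, ?_⟩
        have : {n | heads ω n = N} = ∅ := by
          ext n
          simpa using fun hn => h ⟨n, hn⟩
        rw [headTime, this, Nat.sInf_empty]
    · rintro (⟨h1, h2⟩ | ⟨h1, h2⟩)
      · refine le_antisymm (Nat.sInf_le h1) (not_lt.1 fun hlt => ?_)
        exact h2 ⟨_, hlt⟩ (heads_headTime h1)
      · have : {n | heads ω n = N} = ∅ := by
          ext n
          simpa using h1 n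
        rw [headTime, this, Nat.sInf_empty, h2]
  rw [he]
  exact ((hm n).inter (MeasurableSet.iInter fun m : Fin n => (hm m).compl)).union
    ((MeasurableSet.iInter fun m => (hm m).compl).inter (MeasurableSet.const _))

lemma measurable_longestRedRun_headTime (N : ℕ) :
    Measurable fun ω => longestRedRun ω (headTime ω N) := by
  have h : ∀ n, Measurable fun ω => longestRedRun ω n := fun n =>
    measurable_of_dependsOn (dependsOn_longestRedRun n)
  have h1 : Measurable (Function.uncurry longestRedRun) := measurable_from_prod_countable_left h
  have h2 : Measurable fun ω : ℕ → Bool => (ω, headTime ω N) :=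
    measurable_id.prodMk (measurable_headTime N)
  simpa only [Function.comp_def, Function.uncurry] using h1.comp h2

/-- A red run that occurs before the `N`-th head starts at one of the first `N` heads, and the
tosses after its first head are independent of the past. -/
lemma prob_le_longestRedRun_headTime_le (p : unitInterval) (m N : ℕ) :
    (tossMeasure p).real {ω | m + 1 ≤ longestRedRun ω (headTime ω N)} ≤ N * (p : ℝ) ^ m := by
  have hp0 : (0 : ℝ) ≤ p := p.2.1
  let A : ℕ → (ℕ → Bool) → Prop := fun c ω => heads ω c < N ∧ ω (c + 1) = true
  have hA : ∀ c, DependsOn (A c) (Set.Iic (c + 1)) := fun c x y h => by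
    have h1 : heads x c = heads y c := dependsOn_heads c fun i hi =>
      h i (Nat.le_succ_of_le (Set.mem_Iic.1 hi) :)
    simp only [A, h1, h (c + 1) (Set.mem_Iic.2 le_rfl)]
  let B : ℕ → Set (ℕ → Bool) := fun c =>
    {ω | A c ω ∧ ∀ i ∈ Finset.Ioc (c + 1) (c + 1 + m), ω i = true}
  have hB : ∀ c, (tossMeasure p).real (B c) = (p : ℝ) ^ m * (tossMeasure p).real {ω | A c ω} := by
    intro c
    have h := prob_and_heads p (le_refl _) (hA c) (Finset.Ioc (c + 1) (c + 1 + m)) fun i hi hi' => by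
      rw [Finset.mem_Ioc] at hi
      rw [Set.mem_Iic] at hi'
      omega
    rwa [Nat.card_Ioc, Nat.add_sub_cancel_left] at h
  have hsub : {ω | m + 1 ≤ longestRedRun ω (headTime ω N)} ⊆ ⋃ c, B c := by
    intro ω hω
    obtain ⟨c, hc1, hc2, -⟩ := (le_longestRedRun_iff (Nat.succ_pos m)).1 hω
    have hhead : ω (c + 1) = true := hc2 _ (Finset.mem_Ioc.2 (by omega))
    refine Set.mem_iUnion.2 ⟨c, ⟨?_, hhead⟩, fun i hi => hc2 i ?_⟩
    · have h1 := heads_mono ω (show c + 1 ≤ headTime ω N by omega)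
      rw [heads_succ, if_pos hhead] at h1
      have h2 := heads_headTime_le ω N
      omega
    · rw [Finset.mem_Ioc] at hi ⊢
      omega
  have hsum : ∀ n, ∑ c ∈ Finset.range n, (tossMeasure p).real {ω | A c ω} ≤ N := by
    intro n
    classical
    have hpt : ∀ ω : ℕ → Bool, ∑ c ∈ Finset.range n, (if A c ω then (1 : ℝ) else 0) =
        min (heads ω n) N := by
      intro ω
      induction n with
      | zero => simp [heads_zero]
      | succ n ih =>
        rw [Finset.sum_range_succ, ih, heads_succ]
        by_cases h1 : ω (n + 1) = true <;> by_cases h2 : heads ω n < N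
        · rw [if_pos ⟨h2, h1⟩, if_pos h1, min_eq_left (by omega), min_eq_left (by omega)]
          push_cast; ring
        · rw [if_neg (fun h => h2 h.1), if_pos h1, min_eq_right (by omega),
            min_eq_right (by omega), add_zero]
        · rw [if_neg (fun h => h1 h.2), if_neg h1, add_zero, add_zero]
        · rw [if_neg (fun h => h1 h.2), if_neg h1, add_zero, add_zero]
    calc _ = ∑ c ∈ Finset.range n, ∫ ω, (if A c ω then (1 : ℝ) else 0) ∂(tossMeasure p) :=
          Finset.sum_congr rfl fun c _ =>
            (integral_ite_eq_prob p (measurableSet_of_dependsOn (hA c))).symm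
      _ = ∫ ω, ∑ c ∈ Finset.range n, (if A c ω then (1 : ℝ) else 0) ∂(tossMeasure p) :=
          (integral_finsetSum _ fun c _ =>
            integrable_ite p (measurableSet_of_dependsOn (hA c))).symm
      _ ≤ ∫ _ω, (N : ℝ) ∂(tossMeasure p) := by
          refine integral_mono (integrable_finsetSum _ fun c _ =>
            integrable_ite p (measurableSet_of_dependsOn (hA c))) (integrable_const _) fun ω => ?_
          simp only [hpt]
          exact_mod_cast min_le_right _ _
      _ = N := by simp
  have hbound : (tossMeasure p) (⋃ c, B c) ≤ ENNReal.ofReal (N * (p : ℝ) ^ m) := by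
    refine (measure_iUnion_le _).trans (ENNReal.tsum_le_of_sum_range_le fun n => ?_)
    calc ∑ c ∈ Finset.range n, (tossMeasure p) (B c)
        = ∑ c ∈ Finset.range n, ENNReal.ofReal ((tossMeasure p).real (B c)) :=
          Finset.sum_congr rfl fun c _ => (ofReal_measureReal (measure_ne_top _ _)).symm
      _ = ENNReal.ofReal (∑ c ∈ Finset.range n, (tossMeasure p).real (B c)) :=
          (ENNReal.ofReal_sum_of_nonneg fun _ _ => measureReal_nonneg).symm
      _ ≤ ENNReal.ofReal (N * (p : ℝ) ^ m) := by
          refine ENNReal.ofReal_le_ofReal ?_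
          simp only [hB]
          rw [← Finset.mul_sum, mul_comm]
          exact mul_le_mul_of_nonneg_right (hsum n) (pow_nonneg hp0 m)
  exact ENNReal.toReal_le_of_le_ofReal (mul_nonneg (Nat.cast_nonneg N) (pow_nonneg hp0 m))
    ((measure_mono hsub).trans hbound)

lemma integral_half_pow_heads (p : unitInterval) (M : ℕ) :
    ∫ ω, (1 / 2 : ℝ) ^ heads ω M ∂(tossMeasure p) = (1 - (p : ℝ) / 2) ^ M := by
  have hd : ∀ M, DependsOn (fun ω => (1 / 2 : ℝ) ^ heads ω M) (Set.Iic M) := fun M x y h => by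
    have h1 : heads x M = heads y M := dependsOn_heads M h
    simp only [h1]
  induction M with
  | zero => simp [heads_zero]
  | succ M ih =>
    have e : ∀ (ω : ℕ → Bool) (b : Bool), heads (Function.update ω (M + 1) b) M = heads ω M :=
      update_eq_of_dependsOn (dependsOn_heads M) (by simp)
    rw [integral_toss p (hd (M + 1)) (M + 1)]
    simp only [heads_succ, Function.update_self, e, if_true, Bool.false_eq_true, if_false,
      add_zero, pow_succ]
    rw [integral_mul_const, ih]
    ring

lemma tendsto_prob_heads_lt (p : unitInterval) (hp : 0 < (p : ℝ)) (N : ℕ) :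
    Tendsto (fun M => (tossMeasure p).real {ω | heads ω M < N}) atTop (nhds 0) := by
  have hp1 : (p : ℝ) ≤ 1 := p.2.2
  have hlim : Tendsto (fun M : ℕ => 2 ^ N * (1 - (p : ℝ) / 2) ^ M) atTop (nhds 0) := by
    simpa using (tendsto_pow_atTop_nhds_zero_of_lt_one (r := 1 - (p : ℝ) / 2)
      (by linarith) (by linarith)).const_mul (2 ^ N)
  refine squeeze_zero (fun _ => measureReal_nonneg) (fun M => ?_) hlim
  have hms : MeasurableSet {ω : ℕ → Bool | heads ω M < N} :=
    measurableSet_of_dependsOn (n := M) fun x y h => by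
      have h1 : heads x M = heads y M := dependsOn_heads M h
      simp only [h1]
  have hi : Integrable (fun ω => (1 / 2 : ℝ) ^ heads ω M) (tossMeasure p) :=
    integrable_of_dependsOn p (n := M) fun x y h => by
      have h1 : heads x M = heads y M := dependsOn_heads M h
      simp only [h1]
  rw [← integral_half_pow_heads, ← integral_const_mul, ← integral_ite_eq_prob p hms]
  refine integral_mono (integrable_ite p hms) (hi.const_mul _) fun ω => ?_
  simp only
  split_ifs with h
  · obtain ⟨l, hl⟩ : ∃ l, N = heads ω M + l := ⟨N - heads ω M, by omega⟩
    rw [hl, pow_add, mul_right_comm, ← mul_pow]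
    norm_num
    exact one_le_pow₀ (by norm_num)
  · positivity

/-- Redness with respect to a distant horizon `M` implies redness with respect to the time of the
`N`-th head, which is at least `N`, and at most `M` with high probability. -/
lemma mul_prob_longestRedRun_headTime_lt_le (p : unitInterval) (hp : 1 / 2 < (p : ℝ))
    (hp1 : (p : ℝ) < 1) {k : ℕ} (hk : 1 ≤ k) (N : ℕ) :
    N * (tossMeasure p).real {ω | ¬ k ≤ longestRedRun ω (headTime ω N)} ≤
      waitConst p * (1 / (p : ℝ)) ^ k := by
  have hlim := ((tendsto_prob_heads_lt p (by linarith) N).const_mul (N : ℝ)).const_add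
    (waitConst p * (1 / (p : ℝ)) ^ k)
  rw [mul_zero, add_zero] at hlim
  refine ge_of_tendsto hlim ((eventually_ge_atTop N).mono fun M hM => ?_)
  have hsub : {ω | ¬ k ≤ longestRedRun ω (headTime ω N)} ⊆
      {ω | ¬ ∃ c, c + k ≤ N ∧ RunAt ω M k c} ∪ {ω | heads ω M < N} := by
    intro ω hω
    rw [Set.mem_union, Set.mem_ofPred_eq, Set.mem_ofPred_eq]
    rw [Set.mem_ofPred_eq] at hω
    by_contra! hcon
    obtain ⟨⟨c, hcN, -, hc2, hc3⟩, hh⟩ := hcon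
    obtain ⟨n, hnM, hn⟩ := exists_heads_eq hh
    have hle : headTime ω N ≤ M := (Nat.sInf_le (s := {n | heads ω n = N}) hn).trans hnM
    have hge : N ≤ headTime ω N := by
      conv_lhs => rw [← heads_headTime hn]
      exact heads_le ω _
    refine hω ((le_longestRedRun_iff hk).2 ⟨c, hcN.trans hge, hc2, fun j hj => hc3 j ?_⟩)
    rw [Finset.mem_Icc] at hj ⊢
    omega
  have h1 := (measureReal_mono hsub).trans (measureReal_union_le (μ := tossMeasure p) _ _)
  have h2 := mul_prob_not_exists_runAt_le p hp hp1 hM hk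
  have h3 := mul_le_mul_of_nonneg_left h1 (Nat.cast_nonneg (α := ℝ) N)
  linarith

/-! ### The expected number of red runs -/

lemma expectedRedRuns_eq_sum (p : unitInterval) {k : ℕ} (hk : 1 ≤ k) (N : ℕ) :
    expectedRedRuns p k N =
      ∑ c ∈ Finset.range (N + 1 - k), (tossMeasure p).real {ω | RunAt ω N k c} := by
  classical
  have hms : ∀ c, MeasurableSet {ω | RunAt ω N k c} := fun c =>
    measurableSet_of_dependsOn (dependsOn_runAt N k c)
  calc expectedRedRuns p k N
      = ∫ ω, ∑ c ∈ Finset.range (N + 1 - k), (if RunAt ω N k c then (1 : ℝ) else 0)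
          ∂(tossMeasure p) := by
        refine integral_congr_ae (Eventually.of_forall fun ω => ?_)
        simp only [numRedRuns_eq_sum hk]
        push_cast
        rfl
    _ = ∑ c ∈ Finset.range (N + 1 - k), ∫ ω, (if RunAt ω N k c then (1 : ℝ) else 0)
          ∂(tossMeasure p) := integral_finsetSum _ fun c _ => integrable_ite p (hms c)
    _ = _ := Finset.sum_congr rfl fun c _ => integral_ite_eq_prob p (hms c)

lemma expectedRedRuns_div_le (p : unitInterval) {k : ℕ} (hk : 1 ≤ k) {N : ℕ} (hN : 1 ≤ N) :
    expectedRedRuns p k N / N ≤ (p : ℝ) ^ (k - 1) := by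
  have hp0 : (0 : ℝ) ≤ p := p.2.1
  have hp1 : (p : ℝ) ≤ 1 := p.2.2
  rw [div_le_iff₀ (by exact_mod_cast hN), expectedRedRuns_eq_sum p hk]
  calc _ ≤ ∑ c ∈ Finset.range (N + 1 - k), (p : ℝ) ^ k :=
        Finset.sum_le_sum fun c _ => prob_runAt_le p N k c
    _ = ((N + 1 - k : ℕ) : ℝ) * (p : ℝ) ^ k := by simp
    _ ≤ N * (p : ℝ) ^ (k - 1) := by
        refine mul_le_mul (by exact_mod_cast (by omega : N + 1 - k ≤ N))
          (pow_le_pow_of_le_one hp0 hp1 (Nat.sub_le k 1)) (pow_nonneg hp0 k) (Nat.cast_nonneg N)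
    _ = _ := mul_comm _ _

lemma eventually_lt_expectedRedRuns_div (p : unitInterval) (hp : 1 / 2 < (p : ℝ)) {k : ℕ}
    (hk : 1 ≤ k) {c : ℝ} (hc : c < (2 * (p : ℝ) - 1) ^ 2 / p * (p : ℝ) ^ (k - 1)) :
    ∀ᶠ N : ℕ in atTop, c < expectedRedRuns p k N / N := by
  have hp0 : (0 : ℝ) < p := by linarith
  have hp1 : (p : ℝ) ≤ 1 := p.2.2
  set a : ℝ := (p : ℝ) ^ k * ((2 * p - 1) / p) with ha
  -- The bound `a` obtained here is larger than the asserted one by the factor `p / (2 p - 1) ≥ 1`.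
  have hca : c < a := by
    refine hc.trans_le ?_
    obtain ⟨m, rfl⟩ : ∃ m, k = m + 1 := ⟨k - 1, by omega⟩
    have h1 : a = (2 * p - 1) * (p : ℝ) ^ m := by
      rw [ha, pow_succ]
      field_simp
    rw [h1, Nat.add_sub_cancel]
    refine mul_le_mul_of_nonneg_right ?_ (pow_nonneg hp0.le m)
    rw [div_le_iff₀ hp0]
    nlinarith
  have hlim : Tendsto (fun N : ℕ => a - a * (k - 1) / N) atTop (nhds a) := by
    simpa using (tendsto_const_div_atTop_nhds_zero_nat (a * (k - 1))).const_sub a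
  filter_upwards [hlim.eventually_const_lt hca, eventually_ge_atTop k] with N hN hkN
  refine hN.trans_le ?_
  have hN0 : (0 : ℝ) < N := by exact_mod_cast (by omega : 0 < N)
  rw [le_div_iff₀ hN0, expectedRedRuns_eq_sum p hk]
  calc (a - a * (k - 1) / N) * N = ((N + 1 - k : ℕ) : ℝ) * a := by
        rw [Nat.cast_sub (by omega)]
        push_cast
        field_simp
        ring
    _ = ∑ c ∈ Finset.range (N + 1 - k), a := by simp
    _ ≤ _ := Finset.sum_le_sum fun c hc => le_prob_runAt p hp (by
        rw [Finset.mem_range] at hc; omega)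

/-! ### The number of tosses needed -/

lemma needsOrderTosses (p : unitInterval) (hp : 1 / 2 < (p : ℝ)) (hp1 : (p : ℝ) < 1) :
    NeedsOrderTosses p (1 / (p : ℝ)) := by
  intro ε hε
  have hp0 : (0 : ℝ) < p := by linarith
  have hW := waitConst_pos hp hp1
  refine ⟨ε, waitConst p / ε, hε, div_pos hW hε, fun k hk N => ⟨fun h => ?_, fun h => ?_⟩⟩
  · refine (prob_exists_isRedRun_le p hk N).trans ?_
    refine (mul_le_mul_of_nonneg_right h (pow_nonneg hp0.le k)).trans (le_of_eq ?_)
    rw [mul_assoc, ← mul_pow, one_div_mul_cancel hp0.ne', one_pow, mul_one]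
  · have h1 := mul_prob_longestRedRun_lt_le p hp hp1 hk N
    have hms : MeasurableSet {ω | k ≤ longestRedRun ω N} :=
      measurable_of_dependsOn (dependsOn_longestRedRun N) measurableSet_Ici
    have h2 : (tossMeasure p).real {ω | ¬ k ≤ longestRedRun ω N} =
        1 - (tossMeasure p).real {ω | k ≤ longestRedRun ω N} := probReal_compl_eq_one_sub hms
    rw [h2, prob_le_longestRedRun p hk] at h1
    have hx : (0 : ℝ) < (1 / p) ^ k := by positivity
    have hN : (0 : ℝ) < N := lt_of_lt_of_le (by positivity) h
    have h3 : waitConst p * (1 / (p : ℝ)) ^ k ≤ N * ε := by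
      rw [div_mul_eq_mul_div, div_le_iff₀ hε] at h
      exact h
    have h4 := le_of_mul_le_mul_left (h1.trans h3) hN
    linarith

/-! ### The expected length of the longest red run -/

/-- If the tail probabilities of an integer-valued random variable `f ≤ N` are at most
`N * p ^ (k - 1)`, and those of the complements at most `W * (1 / p) ^ k / N`, then the expectation
of `f` is within a bounded distance of `log N / log (1 / p)`. -/
lemma abs_integral_sub_log_le (p : unitInterval) (hp0 : 0 < (p : ℝ)) (hp1 : (p : ℝ) < 1)
    {W : ℝ} (hW : 0 ≤ W) {N : ℕ} (hN : 1 ≤ N) {f : (ℕ → Bool) → ℕ} (hf : Measurable f)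
    (hfN : ∀ ω, f ω ≤ N)
    (hup : ∀ k : ℕ, (tossMeasure p).real {ω | k + 1 ≤ f ω} ≤ N * (p : ℝ) ^ k)
    (hlow : ∀ k : ℕ, N * (tossMeasure p).real {ω | ¬ k + 1 ≤ f ω} ≤ W * (1 / (p : ℝ)) ^ (k + 1)) :
    |∫ ω, (f ω : ℝ) ∂(tossMeasure p) - Real.log N / Real.log (1 / (p : ℝ))| ≤
      1 + (W + 1) * (1 - (p : ℝ))⁻¹ := by
  have hN1 : (1 : ℝ) ≤ N := by exact_mod_cast hN
  have hN0 : (0 : ℝ) < N := by linarith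
  have hq0 : (0 : ℝ) < (1 - (p : ℝ))⁻¹ := inv_pos.2 (by linarith)
  have hlog : 0 < Real.log (1 / (p : ℝ)) := Real.log_pos (by rw [lt_div_iff₀ hp0]; linarith)
  set x := Real.log N / Real.log (1 / (p : ℝ)) with hx
  have hx0 : 0 ≤ x := div_nonneg (Real.log_nonneg hN1) hlog.le
  have hxlog : x * Real.log (1 / (p : ℝ)) = Real.log N := div_mul_cancel₀ _ hlog.ne'
  have hms : ∀ k : ℕ, MeasurableSet {ω | k + 1 ≤ f ω} := fun k => hf measurableSet_Ici
  have hpt : ∀ (n : ℕ) (ω : ℕ → Bool),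
      ∑ k ∈ Finset.range n, (if k + 1 ≤ f ω then (1 : ℝ) else 0) = (min n (f ω) : ℕ) := by
    intro n ω
    rw [← Finset.sum_filter, Finset.sum_const, nsmul_eq_mul, mul_one]
    congr 1
    have : (Finset.range n).filter (fun k => k + 1 ≤ f ω) = Finset.range (min n (f ω)) := by
      ext j
      simp only [Finset.mem_filter, Finset.mem_range]
      omega
    rw [this, Finset.card_range]
  have hfi : Integrable (fun ω => (f ω : ℝ)) (tossMeasure p) := by
    refine Integrable.of_bound (C := N)
      (measurable_from_top.comp hf : Measurable fun ω => (f ω : ℝ)).aestronglyMeasurable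
      (Eventually.of_forall fun ω => ?_)
    rw [Real.norm_natCast]
    exact_mod_cast hfN ω
  have hint : ∀ n : ℕ, ∫ ω, ∑ k ∈ Finset.range n, (if k + 1 ≤ f ω then (1 : ℝ) else 0)
      ∂(tossMeasure p) = ∑ k ∈ Finset.range n, (tossMeasure p).real {ω | k + 1 ≤ f ω} := by
    intro n
    rw [integral_finsetSum _ fun k _ => integrable_ite p (hms k)]
    exact Finset.sum_congr rfl fun k _ => integral_ite_eq_prob p (hms k)
  have hinti : ∀ n : ℕ, Integrable
      (fun ω => ∑ k ∈ Finset.range n, (if k + 1 ≤ f ω then (1 : ℝ) else 0)) (tossMeasure p) :=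
    fun n => integrable_finsetSum _ fun k _ => integrable_ite p (hms k)
  have hupper : ∫ ω, (f ω : ℝ) ∂(tossMeasure p) ≤ x + 1 + (1 - (p : ℝ))⁻¹ := by
    set K := ⌈x⌉₊ with hK
    have hpK : N * (p : ℝ) ^ K ≤ 1 := by
      have h1 : (N : ℝ) ≤ (1 / p) ^ K := by
        rw [← Real.log_le_log_iff hN0 (by positivity), Real.log_pow, ← hxlog]
        exact mul_le_mul_of_nonneg_right (Nat.le_ceil x) hlog.le
      refine (mul_le_mul_of_nonneg_right h1 (pow_nonneg hp0.le K)).trans (le_of_eq ?_)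
      rw [← mul_pow, one_div_mul_cancel hp0.ne', one_pow]
    calc ∫ ω, (f ω : ℝ) ∂(tossMeasure p)
        ≤ ∫ ω, ∑ k ∈ Finset.range (K + N), (if k + 1 ≤ f ω then (1 : ℝ) else 0)
            ∂(tossMeasure p) := by
          refine integral_mono hfi (hinti _) fun ω => ?_
          simp only [hpt]
          have := hfN ω
          exact_mod_cast (by omega : f ω ≤ min (K + N) (f ω))
      _ = ∑ k ∈ Finset.range (K + N), (tossMeasure p).real {ω | k + 1 ≤ f ω} := hint _
      _ ≤ ∑ k ∈ Finset.range K, (1 : ℝ) + ∑ i ∈ Finset.range N, N * (p : ℝ) ^ (K + i) := by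
          rw [Finset.sum_range_add]
          exact add_le_add (Finset.sum_le_sum fun _ _ => measureReal_le_one)
            (Finset.sum_le_sum fun i _ => hup (K + i))
      _ = K + N * (p : ℝ) ^ K * ∑ i ∈ Finset.range N, (p : ℝ) ^ i := by
          simp [pow_add, Finset.mul_sum, mul_assoc]
      _ ≤ (x + 1) + 1 * (1 - (p : ℝ))⁻¹ := by
          refine add_le_add (Nat.ceil_lt_add_one hx0).le ?_
          exact mul_le_mul hpK (geom_sum_le hp0.le hp1 N)
            (Finset.sum_nonneg fun i _ => pow_nonneg hp0.le i) zero_le_one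
      _ = _ := by ring
  have hlower : x - 1 - W * (1 - (p : ℝ))⁻¹ ≤ ∫ ω, (f ω : ℝ) ∂(tossMeasure p) := by
    set K := ⌊x⌋₊ with hK
    have hpK : (1 / (p : ℝ)) ^ K ≤ N := by
      rw [← Real.log_le_log_iff (by positivity) hN0, Real.log_pow, ← hxlog]
      exact mul_le_mul_of_nonneg_right (Nat.floor_le hx0) hlog.le
    have hgeom : ∑ k ∈ Finset.range K, (1 / (p : ℝ)) ^ (k + 1) ≤ N * (1 - (p : ℝ))⁻¹ := by
      calc ∑ k ∈ Finset.range K, (1 / (p : ℝ)) ^ (k + 1)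
          = ∑ k ∈ Finset.range K, (1 / (p : ℝ)) ^ K * (p : ℝ) ^ k := by
            rw [← Finset.sum_range_reflect]
            refine Finset.sum_congr rfl fun k hk => ?_
            rw [Finset.mem_range] at hk
            obtain ⟨l, hl⟩ : ∃ l, K = l + 1 + k := ⟨K - 1 - k, by omega⟩
            rw [hl, show l + 1 + k - 1 - k + 1 = l + 1 by omega, pow_add _ (l + 1) k, mul_assoc,
              ← mul_pow, one_div_mul_cancel hp0.ne', one_pow, mul_one]
        _ = (1 / (p : ℝ)) ^ K * ∑ k ∈ Finset.range K, (p : ℝ) ^ k := by rw [Finset.mul_sum]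
        _ ≤ N * (1 - (p : ℝ))⁻¹ := mul_le_mul hpK (geom_sum_le hp0.le hp1 K)
            (Finset.sum_nonneg fun i _ => pow_nonneg hp0.le i) hN0.le
    have hk : ∀ k : ℕ, 1 - W / N * (1 / (p : ℝ)) ^ (k + 1) ≤
        (tossMeasure p).real {ω | k + 1 ≤ f ω} := by
      intro k
      have h1 := hlow k
      have h2 : (tossMeasure p).real {ω | ¬ k + 1 ≤ f ω} =
          1 - (tossMeasure p).real {ω | k + 1 ≤ f ω} := probReal_compl_eq_one_sub (hms k)
      rw [h2, mul_comm, ← le_div_iff₀ hN0, ← div_mul_eq_mul_div] at h1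
      linarith
    calc x - 1 - W * (1 - (p : ℝ))⁻¹ ≤ K - W / N * (N * (1 - (p : ℝ))⁻¹) := by
          have h1 := (Nat.lt_floor_add_one x).le
          have h2 : W / N * (N * (1 - (p : ℝ))⁻¹) = W * (1 - (p : ℝ))⁻¹ := by
            rw [← mul_assoc, div_mul_cancel₀ _ hN0.ne']
          rw [h2]
          linarith
      _ ≤ K - W / N * ∑ k ∈ Finset.range K, (1 / (p : ℝ)) ^ (k + 1) :=
          sub_le_sub_left (mul_le_mul_of_nonneg_left hgeom (div_nonneg hW hN0.le)) _
      _ = ∑ k ∈ Finset.range K, (1 - W / N * (1 / (p : ℝ)) ^ (k + 1)) := by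
          rw [Finset.sum_sub_distrib, ← Finset.mul_sum]
          simp
      _ ≤ ∑ k ∈ Finset.range K, (tossMeasure p).real {ω | k + 1 ≤ f ω} :=
          Finset.sum_le_sum fun k _ => hk k
      _ = ∫ ω, ∑ k ∈ Finset.range K, (if k + 1 ≤ f ω then (1 : ℝ) else 0)
            ∂(tossMeasure p) := (hint K).symm
      _ ≤ ∫ ω, (f ω : ℝ) ∂(tossMeasure p) := by
          refine integral_mono (hinti _) hfi fun ω => ?_
          simp only [hpt]
          exact_mod_cast min_le_right _ _
  have hWq : 0 ≤ W * (1 - (p : ℝ))⁻¹ := mul_nonneg hW hq0.le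
  rw [abs_le, add_mul, one_mul]
  constructor <;> linarith

lemma isEquivalent_log_of_abs_sub_le {p C : ℝ} (hp0 : 0 < p) (hp1 : p < 1) {E : ℕ → ℝ}
    (h : ∀ N : ℕ, 1 ≤ N → |E N - Real.log N / Real.log (1 / p)| ≤ C) :
    Asymptotics.IsEquivalent atTop E (fun N : ℕ => Real.log (N : ℝ) / Real.log (1 / p)) := by
  have hlog : 0 < Real.log (1 / p) := Real.log_pos (by rw [lt_div_iff₀ hp0]; linarith)
  have hx : Tendsto (fun N : ℕ => Real.log (N : ℝ) / Real.log (1 / p)) atTop atTop :=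
    (Real.tendsto_log_atTop.comp tendsto_natCast_atTop_atTop).atTop_div_const hlog
  have hO : (fun N : ℕ => E N - Real.log (N : ℝ) / Real.log (1 / p)) =O[atTop]
      fun _ => (1 : ℝ) :=
    Asymptotics.IsBigO.of_bound C ((eventually_ge_atTop 1).mono fun N hN => by
      simpa using h N hN)
  exact hO.trans_isLittleO
    ((Asymptotics.isLittleO_const_left (c := (1 : ℝ))).2
      (Or.inr (tendsto_norm_atTop_atTop.comp hx)))

lemma isEquivalent_expectedLongest (p : unitInterval) (hp : 1 / 2 < (p : ℝ)) (hp1 : (p : ℝ) < 1) :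
    Asymptotics.IsEquivalent atTop (fun N : ℕ => expectedLongest p N)
      (fun N : ℕ => Real.log (N : ℝ) / Real.log (1 / (p : ℝ))) := by
  have hp0 : (0 : ℝ) < p := by linarith
  refine isEquivalent_log_of_abs_sub_le hp0 hp1 fun N hN =>
    abs_integral_sub_log_le p hp0 hp1 (waitConst_pos hp hp1).le hN
      (measurable_of_dependsOn (dependsOn_longestRedRun N))
      (fun ω => (longestRedRun_le_heads ω N).trans (heads_le ω N)) (fun k => ?_)
      (fun k => mul_prob_longestRedRun_lt_le p hp hp1 (Nat.succ_pos k) N)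
  rw [prob_le_longestRedRun p (Nat.succ_pos k)]
  exact (prob_exists_isRedRun_le p (Nat.succ_pos k) N).trans (mul_le_mul_of_nonneg_left
    (pow_le_pow_of_le_one hp0.le hp1.le (Nat.le_succ k)) (Nat.cast_nonneg N))

lemma isEquivalent_expectedLongestHeads (p : unitInterval) (hp : 1 / 2 < (p : ℝ))
    (hp1 : (p : ℝ) < 1) :
    Asymptotics.IsEquivalent atTop (fun N : ℕ => expectedLongestHeads p N)
      (fun N : ℕ => Real.log (N : ℝ) / Real.log (1 / (p : ℝ))) := by
  have hp0 : (0 : ℝ) < p := by linarith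
  exact isEquivalent_log_of_abs_sub_le hp0 hp1 fun N hN =>
    abs_integral_sub_log_le p hp0 hp1 (waitConst_pos hp hp1).le hN
      (measurable_longestRedRun_headTime N)
      (fun ω => (longestRedRun_le_heads ω _).trans (heads_headTime_le ω N))
      (fun k => prob_le_longestRedRun_headTime_le p k N)
      (fun k => mul_prob_longestRedRun_headTime_lt_le p hp hp1 (Nat.succ_pos k) N)

end RedHeads

theorem proposition2p3 :
    -- the two-sided bound for the expected number of runs of `k` red heads
    (∀ p : unitInterval, 1 / 2 < (p : ℝ) → ∀ k : ℕ, 1 ≤ k →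
      (∀ c : ℝ, c < (2 * (p : ℝ) - 1) ^ 2 / (p : ℝ) * (p : ℝ) ^ (k - 1) →
        ∀ᶠ N : ℕ in atTop, c < RedHeads.expectedRedRuns p k N / (N : ℝ)) ∧
      (∀ N : ℕ, 1 ≤ N → RedHeads.expectedRedRuns p k N / (N : ℝ) ≤ (p : ℝ) ^ (k - 1))) ∧
    -- the expected longest run, among `N` tosses and among `N` heads, and the number of tosses
    (∀ p : unitInterval, 1 / 2 < (p : ℝ) → (p : ℝ) < 1 →
      Asymptotics.IsEquivalent atTop (fun N : ℕ => RedHeads.expectedLongest p N)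
        (fun N : ℕ => Real.log (N : ℝ) / Real.log (1 / (p : ℝ))) ∧
      Asymptotics.IsEquivalent atTop (fun N : ℕ => RedHeads.expectedLongestHeads p N)
        (fun N : ℕ => Real.log (N : ℝ) / Real.log (1 / (p : ℝ))) ∧
      RedHeads.NeedsOrderTosses p (1 / (p : ℝ))) ∧
    -- the special case `p = 2 / 3`
    (∀ p : unitInterval, (p : ℝ) = 2 / 3 →
      Asymptotics.IsEquivalent atTop (fun N : ℕ => RedHeads.expectedLongest p N)
        (fun N : ℕ => Real.log (N : ℝ) / Real.log (3 / 2)) ∧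
      Asymptotics.IsEquivalent atTop (fun N : ℕ => RedHeads.expectedLongestHeads p N)
        (fun N : ℕ => Real.log (N : ℝ) / Real.log (3 / 2)) ∧
      RedHeads.NeedsOrderTosses p (3 / 2)) := by
  refine ⟨fun p hp k hk => ⟨fun c hc => RedHeads.eventually_lt_expectedRedRuns_div p hp hk hc,
      fun N hN => RedHeads.expectedRedRuns_div_le p hk hN⟩,
    fun p hp hp1 => ⟨RedHeads.isEquivalent_expectedLongest p hp hp1,
      RedHeads.isEquivalent_expectedLongestHeads p hp hp1,
      RedHeads.needsOrderTosses p hp hp1⟩, fun p hp => ?_⟩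
  have h1 : 1 / 2 < (p : ℝ) := by rw [hp]; norm_num
  have h2 : (p : ℝ) < 1 := by rw [hp]; norm_num
  have e : (3 / 2 : ℝ) = 1 / (p : ℝ) := by rw [hp]; norm_num
  rw [e]
  exact ⟨RedHeads.isEquivalent_expectedLongest p h1 h2,
    RedHeads.isEquivalent_expectedLongestHeads p h1 h2, RedHeads.needsOrderTosses p h1 h2⟩
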